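/- Let $R$ be an associative ring with identity and let $T(R)=\begin{pmatrix} R&0\\ R&R\end{pmatrix}$ be the ring of lower triangular $2\times 2$ matrices over $R$. A left $T(R)$-module is identified with a triple $M=(M_1,M_2,\varphi)$, where $M_1,M_2$ are left $R$-modules and $\varphi\colon M_1\to M_2$ is an $R$-homomorphism (here $R\otimes_R M_1$ is identified with $M_1$): the underlying group is $M_1\oplus M_2$ and $\begin{pmatrix} a&0\\ u&b\end{pmatrix}\begin{pmatrix} x\\ y\end{pmatrix}=\begin{pmatrix} ax\\ u\varphi(x)+by\end{pmatrix}$. A left module $X$ over a ring $S$ is called Ding projective if there is an exact sequence $\cdots\to P^{-1}\to P^0\to P^1\to\cdots$ of projective left $S$-modules with $X\cong\ker(P^0\to P^1)$ which remains exact after applying $\mathrm{Hom}_S(-,G)$ for every flat left $S$-module $G$. Then the following conditions are equivalent: 1. $M=(M_1,M_2,\varphi)$ is a Ding projective left $T(R)$-module. 2. $M_1$ and $M_2/\mathrm{im}\,\varphi$ are Ding projective left $R$-modules, and $\varphi$ is a monomorphism. 3. $M_2$ and $M_2/\mathrm{im}\,\varphi$ are Ding projective left $R$-modules, and $\varphi$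 is a monomorphism. -/

import Mathlib

open scoped TensorProduct

universe u v w

/-! ### Flat modules over a (not necessarily commutative) ring -/

section Flat

variable (R : Type u) [Ring R]

/-- The subgroup of `N ⊗ M` (tensor product over `ℤ`) generated by all elements
`n r ⊗ m - n ⊗ r m`, for a right `R`-module `N` and a left `R`-module `M`. -/
def balancedRelations (N : Type w) [AddCommGroup N] [Module Rᵐᵒᵖ N]
    (M : Type v) [AddCommGroup M] [Module R M] : AddSubgroup (N ⊗[ℤ] M) :=
  AddSubgroup.closure
    {t | ∃ (n : N) (r : R) (m : M), t = (MulOpposite.op r • n) ⊗ₜ[ℤ] m - n ⊗ₜ[ℤ] (r • m)}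

/-- The tensor product `N ⊗_R M` of a right `R`-module `N` and a left `R`-module `M`, an abelian
group. Right `R`-modules are modules over the opposite ring. -/
abbrev BalancedTensor (N : Type w) [AddCommGroup N] [Module Rᵐᵒᵖ N]
    (M : Type v) [AddCommGroup M] [Module R M] : Type (max w v) :=
  (N ⊗[ℤ] M) ⧸ balancedRelations R N M

theorem balancedRelations_le_comap {N N' : Type w} [AddCommGroup N] [Module Rᵐᵒᵖ N]
    [AddCommGroup N'] [Module Rᵐᵒᵖ N'] (M : Type v) [AddCommGroup M] [Module R M]
    (f : N →ₗ[Rᵐᵒᵖ] N') :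
    balancedRelations R N M ≤ (balancedRelations R N' M).comap
      (f.toAddMonoidHom.toIntLinearMap.rTensor M).toAddMonoidHom := by
  refine (AddSubgroup.closure_le _).2 ?_
  rintro _ ⟨n, r, m, rfl⟩
  refine AddSubgroup.subset_closure ⟨f n, r, m, ?_⟩
  simp

/-- The map `f ⊗ id : N ⊗_R M → N' ⊗_R M` induced by a homomorphism `f : N → N'` of right
`R`-modules. -/
def BalancedTensor.map {N N' : Type w} [AddCommGroup N] [Module Rᵐᵒᵖ N]
    [AddCommGroup N'] [Module Rᵐᵒᵖ N'] (M : Type v) [AddCommGroup M] [Module R M]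
    (f : N →ₗ[Rᵐᵒᵖ] N') : BalancedTensor R N M →+ BalancedTensor R N' M :=
  QuotientAddGroup.map (balancedRelations R N M) (balancedRelations R N' M)
    (f.toAddMonoidHom.toIntLinearMap.rTensor M).toAddMonoidHom (balancedRelations_le_comap R M f)

/-- A left `R`-module `M` is flat if `- ⊗_R M` preserves injectivity of homomorphisms of right
`R`-modules. (It is enough to test right modules in the universe of `R`, since the inclusions of
right ideals into `R` are already sufficient.) -/
def IsFlatModule (M : Type v) [AddCommGroup M] [Module R M] : Prop :=
  ∀ (N N' : Type u) [AddCommGroup N] [AddCommGroup N'] [Module Rᵐᵒᵖ N] [Module Rᵐᵒᵖ N']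
    (f : N →ₗ[Rᵐᵒᵖ] N'),
    Function.Injective f → Function.Injective (BalancedTensor.map R M f)

end Flat

/-! ### Ding projective modules -/

/-- A sequence `⋯ → X (-1) → X 0 → X 1 → ⋯` of left `R`-modules. -/
structure ModuleSequence (R : Type u) [Ring R] where
  /-- the terms -/
  X : ℤ → Type w
  [addCommGroup : ∀ i, AddCommGroup (X i)]
  [module : ∀ i, Module R (X i)]
  /-- the differentials -/
  d : ∀ i, X i →ₗ[R] X (i + 1)

attribute [instance] ModuleSequence.addCommGroup ModuleSequence.module

namespace ModuleSequence

variable {R : Type u} [Ring R] (P : ModuleSequence.{u, w} R)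

/-- Exactness at every term. -/
def IsExact : Prop :=
  ∀ i, Function.Exact (P.d i) (P.d (i + 1))

/-- Exactness of the sequence of abelian groups
`⋯ → Hom_R(X (i+2), G) → Hom_R(X (i+1), G) → Hom_R(X i, G) → ⋯` at every term. -/
def IsHomExact (G : Type v) [AddCommGroup G] [Module R G] : Prop :=
  ∀ i, Function.Exact
    (fun f : P.X (i + 1 + 1) →ₗ[R] G => f.comp (P.d (i + 1)))
    (fun f : P.X (i + 1) →ₗ[R] G => f.comp (P.d i))

end ModuleSequence

/-- A left `R`-module `M` is Ding projective if there is an exact sequence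
`⋯ → P (-1) → P 0 → P 1 → ⋯` of projective left `R`-modules with `M ≅ ker (P 0 → P 1)` which
remains exact after applying `Hom_R(-, G)` for every flat left `R`-module `G`. -/
def IsDingProjective (R : Type u) [Ring R] (M : Type v) [AddCommGroup M] [Module R M] : Prop :=
  ∃ P : ModuleSequence.{u, max u v} R,
    (∀ i, Module.Projective R (P.X i)) ∧
    P.IsExact ∧
    Nonempty (M ≃ₗ[R] LinearMap.ker (P.d 0)) ∧
    ∀ (G : Type (max u v)) [AddCommGroup G] [Module R G], IsFlatModule R G → P.IsHomExact G

/-! ### The triangular matrix ring and its modules -/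

/-- The ring `T(R)` of lower triangular `2 × 2` matrices over `R`. -/
def TriangularRing (R : Type u) [Ring R] : Subring (Matrix (Fin 2) (Fin 2) R) where
  carrier := {A | A 0 1 = 0}
  mul_mem' {A B} hA hB := by
    simp only [Set.mem_ofPred_eq] at hA hB ⊢
    simp [Matrix.mul_apply, Fin.sum_univ_two, hA, hB]
  one_mem' := by simp
  add_mem' {A B} hA hB := by
    simp only [Set.mem_ofPred_eq] at hA hB ⊢
    simp [hA, hB]
  zero_mem' := by simp
  neg_mem' {A} hA := by
    simp only [Set.mem_ofPred_eq] at hA ⊢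
    simp [hA]

/-- The underlying group `M₁ ⊕ M₂` of the left `T(R)`-module given by the triple `(M₁, M₂, φ)`,
where `φ : M₁ → M₂` is `R`-linear (a homomorphism `R ⊗_R M₁ → M₂` is the same thing as a
homomorphism `M₁ → M₂`, through `R ⊗_R M₁ = M₁`). -/
def TripleModule {R : Type u} [Ring R] {M₁ M₂ : Type v} [AddCommGroup M₁] [AddCommGroup M₂]
    [Module R M₁] [Module R M₂] (_φ : M₁ →ₗ[R] M₂) : Type v :=
  M₁ × M₂

namespace TripleModule

variable {R : Type u} [Ring R] {M₁ M₂ : Type v} [AddCommGroup M₁] [AddCommGroup M₂]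
  [Module R M₁] [Module R M₂] (φ : M₁ →ₗ[R] M₂)

instance instAddCommGroup : AddCommGroup (TripleModule φ) :=
  inferInstanceAs (AddCommGroup (M₁ × M₂))

/-- The matrix with rows `(a, 0)` and `(u, b)` sends the column `(x, y)` to
`(a x, u φ(x) + b y)`. -/
instance instModule : Module (TriangularRing R) (TripleModule φ) where
  smul A m := (A.1 0 0 • m.1, A.1 1 0 • φ m.1 + A.1 1 1 • m.2)
  one_smul m := by
    refine Prod.ext ?_ ?_
    · change (1 : Matrix (Fin 2) (Fin 2) R) 0 0 • m.1 = m.1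
      simp
    · change (1 : Matrix (Fin 2) (Fin 2) R) 1 0 • φ m.1 +
        (1 : Matrix (Fin 2) (Fin 2) R) 1 1 • m.2 = m.2
      simp
  mul_smul A B m := by
    have hA : A.1 0 1 = 0 := A.2
    refine Prod.ext ?_ ?_
    · change (A.1 * B.1) 0 0 • m.1 = A.1 0 0 • B.1 0 0 • m.1
      simp [Matrix.mul_apply, Fin.sum_univ_two, hA, mul_smul]
    · change (A.1 * B.1) 1 0 • φ m.1 + (A.1 * B.1) 1 1 • m.2 =
        A.1 1 0 • φ (B.1 0 0 • m.1) + A.1 1 1 • (B.1 1 0 • φ m.1 + B.1 1 1 • m.2)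
      have hB : B.1 0 1 = 0 := B.2
      simp [Matrix.mul_apply, Fin.sum_univ_two, hB, mul_smul, add_smul, add_assoc]
  smul_zero A := by
    refine Prod.ext ?_ ?_
    · change A.1 0 0 • (0 : M₁) = 0
      simp
    · change A.1 1 0 • φ (0 : M₁) + A.1 1 1 • (0 : M₂) = 0
      simp
  smul_add A m n := by
    refine Prod.ext ?_ ?_
    · change A.1 0 0 • (m.1 + n.1) = A.1 0 0 • m.1 + A.1 0 0 • n.1
      simp
    · change A.1 1 0 • φ (m.1 + n.1) + A.1 1 1 • (m.2 + n.2) =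
        (A.1 1 0 • φ m.1 + A.1 1 1 • m.2) + (A.1 1 0 • φ n.1 + A.1 1 1 • n.2)
      simp only [map_add, smul_add]
      abel
  add_smul A B m := by
    refine Prod.ext ?_ ?_
    · change (A.1 + B.1) 0 0 • m.1 = A.1 0 0 • m.1 + B.1 0 0 • m.1
      simp [add_smul]
    · change (A.1 + B.1) 1 0 • φ m.1 + (A.1 + B.1) 1 1 • m.2 =
        (A.1 1 0 • φ m.1 + A.1 1 1 • m.2) + (B.1 1 0 • φ m.1 + B.1 1 1 • m.2)
      simp only [Matrix.add_apply, add_smul]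
      abel
  zero_smul m := by
    refine Prod.ext ?_ ?_
    · change (0 : Matrix (Fin 2) (Fin 2) R) 0 0 • m.1 = 0
      simp
    · change (0 : Matrix (Fin 2) (Fin 2) R) 1 0 • φ m.1 +
        (0 : Matrix (Fin 2) (Fin 2) R) 1 1 • m.2 = 0
      simp

end TripleModule

-- A module is Ding projective exactly when it sits in a doubly infinite chain of short exact
-- sequences 0 → Z_i → P_i → Z_{i+1} → 0 with P_i projective, such that every map from Z_i to a flat
-- module extends to P_i (`isDingProjective_iff_hasProjectiveChain`). Consecutive links carry no
-- compatibility condition, so a class of modules in which every member has a link to and a link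
-- from another member consists of Ding projectives (`HasProjectiveChain.of_class`). The proof
-- therefore handles one link at a time.
--
-- (1 ⇒ 3) A link of triples is a pair of short exact sequences joined by commuting squares, with a
-- projective triple (P₁, P₂, ρ) in the middle. There ρ is injective and P₂ and coker ρ are
-- projective, so φ is injective, and second components and cokernels again form short exact
-- sequences. If G is flat over R then (G, G, id) and (0, G, 0) are flat over T(R); testing against
-- them gives the extension property for M₂ and for coker φ (`ProjectiveLink.snd`,
-- `ProjectiveLink.coker`).
--
-- (2 ⇒ 1) A horseshoe construction: links P for M₁ and Q for coker φ are combined into a link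
-- through the projective triple (P, P ⊕ Q, inl). In the forward direction the embedding M₁ → P must
-- be extended to M₂, which is possible because P is flat and Ext¹(coker φ, flat) = 0
-- (`HasProjectiveChain.exists_extension`). Both components of a flat triple are flat, which gives
-- the extension property (`ProjectiveLink.triple`).
--
-- (3 ⇒ 2) Ding projectives are closed under kernels of epimorphisms
-- (`HasProjectiveChain.of_kernel`). The closure under extensions needed for this comes from the
-- triangular ring itself: (2 ⇒ 1) followed by passage to second components.

universe v'

/-! ### Balanced tensor products and flatness -/

namespace BalancedTensor

variable {R : Type u} [Ring R] {N : Type w} [AddCommGroup N] [Module Rᵐᵒᵖ N]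
  {M : Type v} [AddCommGroup M] [Module R M]

variable (R) in
/-- The class of `n ⊗ m` in the balanced tensor product. -/
def tmul (n : N) (m : M) : BalancedTensor R N M :=
  QuotientAddGroup.mk' (balancedRelations R N M) (n ⊗ₜ[ℤ] m)

theorem tmul_add (n : N) (m m' : M) : tmul R n (m + m') = tmul R n m + tmul R n m' := by
  simp only [tmul, TensorProduct.tmul_add, map_add]

theorem add_tmul (n n' : N) (m : M) : tmul R (n + n') m = tmul R n m + tmul R n' m := by
  simp only [tmul, TensorProduct.add_tmul, map_add]

theorem zero_tmul (m : M) : tmul R (0 : N) m = 0 := by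
  simp only [tmul, TensorProduct.zero_tmul, map_zero]

theorem tmul_zero (n : N) : tmul R n (0 : M) = 0 := by
  simp only [tmul, TensorProduct.tmul_zero, map_zero]

theorem smul_tmul (r : R) (n : N) (m : M) :
    tmul R (MulOpposite.op r • n) m = tmul R n (r • m) := by
  rw [← sub_eq_zero, tmul, tmul, ← map_sub]
  exact (QuotientAddGroup.eq_zero_iff _).2 (AddSubgroup.subset_closure ⟨n, r, m, rfl⟩)

@[simp] theorem map_tmul {N' : Type w} [AddCommGroup N'] [Module Rᵐᵒᵖ N'] (f : N →ₗ[Rᵐᵒᵖ] N')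
    (n : N) (m : M) : map R M f (tmul R n m) = tmul R (f n) m := by
  simp [map, tmul]

variable {A : Type*} [AddCommGroup A]

theorem hom_ext {f g : BalancedTensor R N M →+ A}
    (h : ∀ n m, f (tmul R n m) = g (tmul R n m)) : f = g := by
  refine DFunLike.ext _ _ fun t => ?_
  obtain ⟨t, rfl⟩ := QuotientAddGroup.mk'_surjective _ t
  induction t with
  | zero => simp
  | tmul n m => exact h n m
  | add a b ha hb => simp only [map_add, ha, hb]

/-- The additive map out of `N ⊗_R M` induced by a balanced biadditive map. -/
def lift (f : N → M → A) (add_right : ∀ n m m', f n (m + m') = f n m + f n m')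
    (add_left : ∀ n n' m, f (n + n') m = f n m + f n' m)
    (smul : ∀ n (r : R) m, f (MulOpposite.op r • n) m = f n (r • m)) :
    BalancedTensor R N M →+ A :=
  QuotientAddGroup.lift _
    (TensorProduct.liftAddHom (AddMonoidHom.mk' (fun n => AddMonoidHom.mk' (f n) (add_right n))
      fun n n' => by ext m; exact add_left n n' m) fun r n m => by
        rw [map_zsmul, map_zsmul]; rfl) <| by
    refine (AddSubgroup.closure_le _).2 ?_
    rintro _ ⟨n, r, m, rfl⟩
    simp [smul]

@[simp] theorem lift_tmul (f : N → M → A) (add_right : ∀ n m m', f n (m + m') = f n m + f n m')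
    (add_left : ∀ n n' m, f (n + n') m = f n m + f n' m)
    (smul : ∀ n (r : R) m, f (MulOpposite.op r • n) m = f n (r • m)) (n : N) (m : M) :
    lift f add_right add_left smul (tmul R n m) = f n m :=
  rfl

end BalancedTensor

/-- Every flatness proof below exhibits one tensored map as a retract of a map known to be
injective; a one-sided inverse on the source suffices, so no tensor product has to be computed up to
isomorphism. -/
theorem Function.Injective.of_retract {A A' B B' : Type*} {f : A → A'} {g : B → B'}
    (hg : Function.Injective g) (a : A → B) (a' : A' → B') (b : B → A)
    (hb : ∀ x, b (a x) = x) (h : ∀ x, a' (f x) = g (a x)) : Function.Injective f := by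
  intro x y hxy
  have : g (a x) = g (a y) := by rw [← h, ← h, hxy]
  rw [← hb x, hg this, hb]

section

variable {R : Type u} [Ring R]

theorem IsFlatModule.of_equiv {M : Type v} [AddCommGroup M] [Module R M] {M' : Type w}
    [AddCommGroup M'] [Module R M'] (e : M ≃ₗ[R] M') (h : IsFlatModule R M) :
    IsFlatModule R M' := by
  intro N N' _ _ _ _ f hf
  let a (N : Type u) [AddCommGroup N] [Module Rᵐᵒᵖ N] :
      BalancedTensor R N M' →+ BalancedTensor R N M :=
    BalancedTensor.lift (fun n m => BalancedTensor.tmul R n (e.symm m))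
      (by simp [BalancedTensor.tmul_add]) (by simp [BalancedTensor.add_tmul])
      (by simp [BalancedTensor.smul_tmul])
  let b : BalancedTensor R N M →+ BalancedTensor R N M' :=
    BalancedTensor.lift (fun n m => BalancedTensor.tmul R n (e m))
      (by simp [BalancedTensor.tmul_add]) (by simp [BalancedTensor.add_tmul])
      (by simp [BalancedTensor.smul_tmul])
  refine (h N N' f hf).of_retract (a N) (a N') b (fun x => ?_) fun x => ?_
  · refine DFunLike.congr_fun (f := b.comp (a N)) (g := .id _) ?_ x
    exact BalancedTensor.hom_ext fun n m => by simp [a, b]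
  · refine DFunLike.congr_fun (f := (a N').comp (BalancedTensor.map R M' f))
      (g := (BalancedTensor.map R M f).comp (a N)) ?_ x
    exact BalancedTensor.hom_ext fun n m => by simp [a]

/-- A section of the free cover of P makes N ⊗ P a natural retract of the direct sum of copies of N
indexed by P, where injectivity is checked entrywise. -/
theorem IsFlatModule.of_projective (P : Type v) [AddCommGroup P] [Module R P]
    [Module.Projective R P] : IsFlatModule R P := by
  intro N N' _ _ _ _ f hf
  obtain ⟨s, hs⟩ := Module.projective_def'.1 ‹Module.Projective R P›
  let c (N : Type u) [AddCommGroup N] [Module Rᵐᵒᵖ N] (n : N) (p : P) : P →₀ N :=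
    (s p).mapRange (fun r => MulOpposite.op r • n) (by simp)
  have hc (N : Type u) [AddCommGroup N] [Module Rᵐᵒᵖ N] (n : N) (p i : P) :
      c N n p i = MulOpposite.op (s p i) • n := rfl
  let a (N : Type u) [AddCommGroup N] [Module Rᵐᵒᵖ N] : BalancedTensor R N P →+ (P →₀ N) :=
    BalancedTensor.lift (c N) (fun n p q => by ext i; simp [hc, add_smul])
      (fun n n' p => by ext i; simp [hc]) fun n r p => by ext i; simp [hc, mul_smul]
  let b : (P →₀ N) →+ BalancedTensor R N P :=
    Finsupp.liftAddHom fun p =>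
      AddMonoidHom.mk' (fun n => BalancedTensor.tmul R n p) fun n n' => BalancedTensor.add_tmul n n' p
  have hmr : Function.Injective (Finsupp.mapRange f f.map_zero : (P →₀ N) → (P →₀ N')) :=
    Finsupp.mapRange_injective _ _ hf
  refine hmr.of_retract (a N) (a N') b (fun x => ?_) fun x => ?_
  · refine DFunLike.congr_fun (f := b.comp (a N)) (g := .id _) ?_ x
    refine BalancedTensor.hom_ext fun n p => ?_
    -- Dual basis expansion of p; moving the coefficients across the tensor sign turns it into `b ∘
    -- a = id`.
    have hp : (s p).sum (fun i r => r • i) = p := by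
      simpa [Finsupp.linearCombination_apply] using LinearMap.congr_fun hs p
    have : ((s p).mapRange (fun r => MulOpposite.op r • n) (by simp)).sum
        (fun i n => BalancedTensor.tmul R n i) = BalancedTensor.tmul R n p := by
      rw [Finsupp.sum_mapRange_index (by simp [BalancedTensor.zero_tmul])]
      conv_rhs => rw [← hp]
      let t : P →+ BalancedTensor R N P :=
        AddMonoidHom.mk' (BalancedTensor.tmul R n) (BalancedTensor.tmul_add n)
      change _ = t _
      rw [map_finsuppSum]
      simp [t, BalancedTensor.smul_tmul]
    refine Eq.trans ?_ this
    simp only [a, b, AddMonoidHom.comp_apply, BalancedTensor.lift_tmul]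
    rfl
  · refine DFunLike.congr_fun (f := (a N').comp (BalancedTensor.map R P f))
      (g := (Finsupp.mapRange.addMonoidHom f.toAddMonoidHom).comp (a N)) ?_ x
    exact BalancedTensor.hom_ext fun n m => by ext i; simp [a, hc]

end

/-! ### Factoring linear maps -/

section Factor

variable {R : Type*} [Ring R] {A B C : Type*} [AddCommGroup A] [AddCommGroup B] [AddCommGroup C]
  [Module R A] [Module R B] [Module R C]

theorem LinearMap.exists_factor_of_surjective {p : A →ₗ[R] B} (hp : Function.Surjective p)
    (f : A →ₗ[R] C) (h : ∀ a, p a = 0 → f a = 0) : ∃ g : B →ₗ[R] C, ∀ a, g (p a) = f a := by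
  have hle : LinearMap.ker p ≤ LinearMap.ker f :=
    fun a ha => LinearMap.mem_ker.2 (h a (LinearMap.mem_ker.1 ha))
  refine ⟨((LinearMap.ker p).liftQ f hle).comp
    (p.quotKerEquivOfSurjective hp).symm.toLinearMap, fun a => ?_⟩
  have : (p.quotKerEquivOfSurjective hp).symm (p a) = (LinearMap.ker p).mkQ a := by
    rw [LinearEquiv.symm_apply_eq]; rfl
  rw [LinearMap.comp_apply, LinearEquiv.coe_coe, this, Submodule.mkQ_apply, Submodule.liftQ_apply]

theorem LinearMap.exists_factor_of_injective {i : B →ₗ[R] C} (hi : Function.Injective i)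
    (f : A →ₗ[R] C) (h : ∀ a, ∃ b, i b = f a) : ∃ g : A →ₗ[R] B, ∀ a, i (g a) = f a := by
  refine ⟨(LinearEquiv.ofInjective i hi).symm.toLinearMap ∘ₗ f.codRestrict (LinearMap.range i) h,
    fun a => ?_⟩
  exact congrArg Subtype.val ((LinearEquiv.ofInjective i hi).apply_symm_apply ⟨f a, h a⟩)

theorem LinearMap.exists_lift_of_projective {P : Type*} [AddCommGroup P] [Module R P]
    [Module.Projective R P] {p : A →ₗ[R] B} (hp : Function.Surjective p) (f : P →ₗ[R] B) :
    ∃ g : P →ₗ[R] A, ∀ x, p (g x) = f x := by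
  obtain ⟨g, hg⟩ := Module.projective_lifting_property p f hp
  exact ⟨g, LinearMap.congr_fun hg⟩

/-- The first term of a short exact sequence with projective middle and last terms is
projective. -/
theorem Module.Projective.of_exact_of_projective {i : A →ₗ[R] B} {p : B →ₗ[R] C}
    (hi : Function.Injective i) (hip : Function.Exact i p) (hp : Function.Surjective p)
    [Module.Projective R B] [Module.Projective R C] :
    Module.Projective R A ∧ ∃ r : B →ₗ[R] A, ∀ a, r (i a) = a := by
  obtain ⟨s, hs⟩ := LinearMap.exists_lift_of_projective hp LinearMap.id
  -- The idempotent `id - s ∘ p` has image in the kernel of `p`, hence in the image of `i`; its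
  -- corestriction is the retraction.
  obtain ⟨r, hr⟩ := LinearMap.exists_factor_of_injective hi (LinearMap.id - s ∘ₗ p)
    fun b => (hip _).1 (by simp [hs])
  have hri : ∀ a, r (i a) = a := fun a => hi (by simp [hr, hip.apply_apply_eq_zero])
  exact ⟨.of_split i r (LinearMap.ext hri), r, hri⟩

end Factor

/-! ### Chains of short exact sequences -/

/-- `Y` is the cokernel of an embedding of `X` into a projective module such that every
homomorphism from `X` to a flat module extends along this embedding. -/
def ProjectiveLink (R : Type u) [Ring R] (X Y : Type w) [AddCommGroup X] [Module R X]
    [AddCommGroup Y] [Module R Y] : Prop :=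
  ∃ (P : Type w) (_ : AddCommGroup P) (_ : Module R P) (i : X →ₗ[R] P) (p : P →ₗ[R] Y),
    Module.Projective R P ∧ Function.Injective i ∧ Function.Exact i p ∧ Function.Surjective p ∧
      ∀ (G : Type w) [AddCommGroup G] [Module R G], IsFlatModule R G → ∀ f : X →ₗ[R] G,
        ∃ g : P →ₗ[R] G, ∀ x, g (i x) = f x

/-- `X` is a term of a doubly infinite chain of modules, consecutive ones being joined by a
projective link. -/
def HasProjectiveChain (R : Type u) [Ring R] (X : Type w) [AddCommGroup X] [Module R X] : Prop :=
  ∃ Z : ℤ → ModuleCat.{w} R, Nonempty (X ≃ₗ[R] Z 0) ∧ ∀ i, ProjectiveLink R (Z i) (Z (i + 1))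

section Chain

variable {R : Type u} [Ring R]

theorem ProjectiveLink.congr {X X' Y Y' : Type w} [AddCommGroup X] [Module R X]
    [AddCommGroup Y] [Module R Y] [AddCommGroup X'] [Module R X'] [AddCommGroup Y'] [Module R Y']
    (e : X ≃ₗ[R] X') (e' : Y ≃ₗ[R] Y') (h : ProjectiveLink R X Y) : ProjectiveLink R X' Y' := by
  obtain ⟨P, _, _, i, p, hP, hi, hip, hp, hG⟩ := h
  refine ⟨P, _, _, i ∘ₗ e.symm.toLinearMap, e'.toLinearMap ∘ₗ p, hP,
    hi.comp e.symm.injective, fun x => ?_, e'.surjective.comp hp, fun G _ _ hGf f => ?_⟩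
  · have := hip x
    simp only [LinearMap.comp_apply, LinearEquiv.coe_coe, e'.map_eq_zero_iff, this, Set.mem_range]
    exact e.symm.surjective.exists
  · obtain ⟨g, hg⟩ := hG G hGf (f ∘ₗ e.toLinearMap)
    exact ⟨g, fun x => by simp [hg]⟩

namespace HasProjectiveChain

variable {X X' : Type w} [AddCommGroup X] [Module R X] [AddCommGroup X'] [Module R X']

theorem congr (e : X ≃ₗ[R] X') (h : HasProjectiveChain R X) : HasProjectiveChain R X' :=
  let ⟨Z, ⟨e₀⟩, hZ⟩ := h
  ⟨Z, ⟨e.symm.trans e₀⟩, hZ⟩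

theorem exists_next (h : HasProjectiveChain R X) :
    ∃ (Y : Type w) (_ : AddCommGroup Y) (_ : Module R Y),
      HasProjectiveChain R Y ∧ ProjectiveLink R X Y := by
  obtain ⟨Z, ⟨e⟩, hZ⟩ := h
  refine ⟨Z (0 + 1), inferInstance, inferInstance, ⟨fun i => Z (i + 1), ⟨.refl _ _⟩,
    fun i => hZ _⟩, (hZ 0).congr e.symm (.refl _ _)⟩

theorem exists_prev (h : HasProjectiveChain R X) :
    ∃ (Y : Type w) (_ : AddCommGroup Y) (_ : Module R Y),
      HasProjectiveChain R Y ∧ ProjectiveLink R Y X := by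
  obtain ⟨Z, ⟨e⟩, hZ⟩ := h
  have key (i : ℤ) : ProjectiveLink R (Z (i - 1)) (Z i) := by
    have := hZ (i - 1)
    rwa [sub_add_cancel] at this
  refine ⟨Z (0 - 1), inferInstance, inferInstance, ⟨fun i => Z (i - 1), ⟨.refl _ _⟩,
    fun i => ?_⟩, (key 0).congr (.refl _ _) e.symm⟩
  -- The argument is left as `i + 1 - 1`, so that only the index of the source has to be rewritten.
  have := key (i + 1 - 1)
  rw [show i + 1 - 1 - 1 = i - 1 by ring] at this
  exact this

/-- A class of modules that is closed under choosing links in both directions consists of modules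
with a projective chain. -/
theorem of_class (D : ∀ (X : Type w) [AddCommGroup X] [Module R X], Prop)
    (next : ∀ (X : Type w) [AddCommGroup X] [Module R X], D X →
      ∃ (Y : Type w) (_ : AddCommGroup Y) (_ : Module R Y), D Y ∧ ProjectiveLink R X Y)
    (prev : ∀ (X : Type w) [AddCommGroup X] [Module R X], D X →
      ∃ (Y : Type w) (_ : AddCommGroup Y) (_ : Module R Y), D Y ∧ ProjectiveLink R Y X)
    (hX : D X) : HasProjectiveChain R X := by
  let S := {M : ModuleCat.{w} R // D M}
  have hn (M : S) : ∃ N : S, ProjectiveLink R M.1 N.1 :=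
    let ⟨Y, _, _, hY, hl⟩ := next M.1 M.2
    ⟨⟨ModuleCat.of R Y, hY⟩, hl⟩
  have hp (M : S) : ∃ N : S, ProjectiveLink R N.1 M.1 :=
    let ⟨Y, _, _, hY, hl⟩ := prev M.1 M.2
    ⟨⟨ModuleCat.of R Y, hY⟩, hl⟩
  choose n hn using hn
  choose p hp using hp
  -- Forward choices are iterated on the right and backward choices on the left of X. The shift `k +
  -- 1` for `negSucc k` puts X at index 0 only, so the step from -1 to 0 is a case of its own.
  let Z : ℤ → S
    | .ofNat k => n^[k] ⟨ModuleCat.of R X, hX⟩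
    | .negSucc k => p^[k + 1] ⟨ModuleCat.of R X, hX⟩
  refine ⟨fun i => (Z i).1, ⟨.refl _ _⟩, fun i => ?_⟩
  rcases i with k | (_ | k)
  · have := hn (Z k)
    rwa [show n (Z k) = Z (k + 1) from (Function.iterate_succ_apply' n k _).symm] at this
  · exact hp _
  · have := hp (Z (.negSucc k))
    rwa [show p (Z (.negSucc k)) = Z (.negSucc (k + 1)) from
      (Function.iterate_succ_apply' p (k + 1) _).symm] at this

/-- Adjoining the isomorphic copies of X to the class of modules with a chain keeps it closed under
links in both directions. -/
theorem of_links {Y Y' : Type w} [AddCommGroup Y] [Module R Y] [AddCommGroup Y'] [Module R Y']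
    (hY : HasProjectiveChain R Y) (hXY : ProjectiveLink R X Y)
    (hY' : HasProjectiveChain R Y') (hYX : ProjectiveLink R Y' X) : HasProjectiveChain R X := by
  refine of_class (fun W _ _ => HasProjectiveChain R W ∨ Nonempty (X ≃ₗ[R] W)) ?_ ?_
    (.inr ⟨.refl _ _⟩)
  · rintro W _ _ (h | ⟨⟨e⟩⟩)
    · obtain ⟨V, _, _, hV, hl⟩ := h.exists_next
      exact ⟨V, _, _, .inl hV, hl⟩
    · exact ⟨Y, _, _, .inl hY, hXY.congr e (.refl _ _)⟩
  · rintro W _ _ (h | ⟨⟨e⟩⟩)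
    · obtain ⟨V, _, _, hV, hl⟩ := h.exists_prev
      exact ⟨V, _, _, .inl hV, hl⟩
    · exact ⟨Y', _, _, .inl hY', hYX.congr (.refl _ _) e⟩

/-- Homomorphisms to flat modules extend along embeddings whose cokernel has a projective chain. -/
theorem exists_extension {E C G : Type w} [AddCommGroup E] [Module R E] [AddCommGroup C]
    [Module R C] [AddCommGroup G] [Module R G] (hC : HasProjectiveChain R C)
    {i : X →ₗ[R] E} {p : E →ₗ[R] C} (hi : Function.Injective i) (hip : Function.Exact i p)
    (hp : Function.Surjective p) (hG : IsFlatModule R G) (f : X →ₗ[R] G) :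
    ∃ g : E →ₗ[R] G, ∀ x, g (i x) = f x := by
  obtain ⟨Y, _, _, -, P, _, _, j, q, _, hj, hjq, hq, hext⟩ := hC.exists_prev
  -- The link Y → P → C is mapped to X → E → C by `l` and the induced `k : Y → X`. Then E is the
  -- pushout of `j` and `k`, so `f` and an extension `g` of `f ∘ k` to P glue to a map on E.
  obtain ⟨l, hl⟩ := LinearMap.exists_lift_of_projective hp q
  obtain ⟨k, hk⟩ := LinearMap.exists_factor_of_injective hi (l ∘ₗ j)
    fun y => (hip _).1 (by simp [hl, hjq.apply_apply_eq_zero])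
  obtain ⟨g, hg⟩ := hext G hG (f ∘ₗ k)
  have hsurj : Function.Surjective (i.coprod l) := by
    intro e
    obtain ⟨a, ha⟩ := hq (p e)
    obtain ⟨x, hx⟩ := (hip (e - l a)).1 (by simp [hl, ha])
    exact ⟨(x, a), by simp [hx]⟩
  -- The kernel of X × P → E consists of the pairs (-k y, j y), on which `f.coprod g` vanishes
  -- because g ∘ j = f ∘ k.
  obtain ⟨h, hh⟩ := LinearMap.exists_factor_of_surjective hsurj (f.coprod g) (by
    rintro ⟨x, a⟩ h0
    simp only [LinearMap.coprod_apply] at h0 ⊢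
    have hqa : q a = 0 := by
      rw [← hl, eq_neg_of_add_eq_zero_right h0, map_neg, hip.apply_apply_eq_zero, neg_zero]
    obtain ⟨y, rfl⟩ := (hjq a).1 hqa
    have : x + k y = 0 := hi (by rw [map_add, hk, map_zero]; exact h0)
    rw [hg, LinearMap.comp_apply, ← map_add, this, map_zero])
  exact ⟨h, fun x => by simpa using hh (x, 0)⟩

/-- The kernel of a homomorphism from a module with a projective chain onto a projective module
has a projective chain. -/
theorem of_exact_of_projective {E Q : Type w} [AddCommGroup E] [Module R E] [AddCommGroup Q]
    [Module R Q] [Module.Projective R Q] (hE : HasProjectiveChain R E)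
    {i : X →ₗ[R] E} {p : E →ₗ[R] Q} (hi : Function.Injective i) (hip : Function.Exact i p)
    (hp : Function.Surjective p) : HasProjectiveChain R X := by
  obtain ⟨Y, _, _, hY, P, _, _, j, q, _, hj, hjq, hq, hext⟩ := hE.exists_next
  obtain ⟨Y', _, _, hY', P', _, _, j', q', _, hj', hjq', hq', hext'⟩ := hE.exists_prev
  refine of_links hY ?_ hY' ?_
  -- Since Q is flat, `p` extends to `r : P → Q`. As `r` is already onto when restricted to E, the
  -- quotient of ker r by X is still P / E = Y.
  · obtain ⟨r, hr⟩ := hext Q (.of_projective Q) p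
    have hrs : Function.Surjective r := fun c => by
      obtain ⟨e, rfl⟩ := hp c
      exact ⟨j e, hr e⟩
    obtain ⟨hK, -⟩ := Module.Projective.of_exact_of_projective
      (LinearMap.ker r).injective_subtype (LinearMap.exact_subtype_ker_map r) hrs
    obtain ⟨t, ht⟩ := LinearMap.exists_factor_of_injective (LinearMap.ker r).injective_subtype
      (j ∘ₗ i) fun x => ⟨⟨j (i x), by simp [hr, hip.apply_apply_eq_zero]⟩, rfl⟩
    have ht' (x) : (t x : P) = j (i x) := ht x
    refine ⟨LinearMap.ker r, _, _, t, q ∘ₗ (LinearMap.ker r).subtype, hK, fun x y h => ?_,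
      fun k => ⟨fun h => ?_, ?_⟩, fun y => ?_, fun G _ _ hG f => ?_⟩
    · exact hi (hj (by rw [← ht', ← ht', h]))
    · obtain ⟨e, he⟩ := (hjq k).1 h
      obtain ⟨x, rfl⟩ := (hip e).1 (by rw [← hr, he]; exact k.2)
      exact ⟨x, Subtype.ext (by rw [ht', he])⟩
    · rintro ⟨x, rfl⟩
      simp [ht', hjq.apply_apply_eq_zero]
    · obtain ⟨a, rfl⟩ := hq y
      obtain ⟨e, he⟩ := hp (r a)
      exact ⟨⟨a - j e, by simp [hr, he]⟩, by simp [hjq.apply_apply_eq_zero]⟩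
    -- X is a direct summand of E, so `f` extends to E through the projection `ρ`, and from there to
    -- P.
    · obtain ⟨s, hs⟩ := LinearMap.exists_lift_of_projective hp LinearMap.id
      obtain ⟨ρ, hρ⟩ := LinearMap.exists_factor_of_injective hi (LinearMap.id - s ∘ₗ p)
        fun b => (hip _).1 (by simp [hs])
      obtain ⟨g, hg⟩ := hext G hG (f ∘ₗ ρ)
      refine ⟨g ∘ₗ (LinearMap.ker r).subtype, fun x => ?_⟩
      have : ρ (i x) = x := hi (by simp [hρ, hip.apply_apply_eq_zero])
      simp [ht', hg, this]
  -- The kernel of P' → E → Q is the preimage of X in P'; it is projective and its map onto X still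
  -- has kernel Y'.
  · have hps : Function.Surjective (p ∘ₗ q') := hp.comp hq'
    obtain ⟨hK, -⟩ := Module.Projective.of_exact_of_projective
      (LinearMap.ker (p ∘ₗ q')).injective_subtype (LinearMap.exact_subtype_ker_map _) hps
    obtain ⟨t, ht⟩ := LinearMap.exists_factor_of_injective
      (LinearMap.ker (p ∘ₗ q')).injective_subtype j'
      fun y => ⟨⟨j' y, by simp [hjq'.apply_apply_eq_zero]⟩, rfl⟩
    have ht' (y) : (t y : P') = j' y := ht y
    obtain ⟨π, hπ⟩ := LinearMap.exists_factor_of_injective hi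
      (q' ∘ₗ (LinearMap.ker (p ∘ₗ q')).subtype) fun k => (hip _).1 k.2
    refine ⟨LinearMap.ker (p ∘ₗ q'), _, _, t, π, hK, fun x y h => ?_,
      fun k => ⟨fun h => ?_, ?_⟩, fun x => ?_, fun G _ _ hG f => ?_⟩
    · exact hj' (by rw [← ht', ← ht', h])
    · obtain ⟨y, hy⟩ := (hjq' k).1 ((hπ k).symm.trans (by rw [h, map_zero]))
      exact ⟨y, Subtype.ext (by rw [ht', hy])⟩
    · rintro ⟨y, rfl⟩
      exact hi (by simp [hπ, ht', hjq'.apply_apply_eq_zero])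
    · obtain ⟨a, ha⟩ := hq' (i x)
      exact ⟨⟨a, by simp [ha, hip.apply_apply_eq_zero]⟩, hi (by simp [hπ, ha])⟩
    · obtain ⟨g, hg⟩ := hext' G hG f
      exact ⟨g ∘ₗ (LinearMap.ker (p ∘ₗ q')).subtype, fun y => by simp [ht', hg]⟩

end HasProjectiveChain

/-- The complex is cut at its kernels, and conversely links are spliced. Exactness of Hom(-, G) says
that a map killing the image of one differential, which is a map on the next kernel, factors through
the following differential, that is, extends from the kernel. -/
theorem isDingProjective_iff_hasProjectiveChain {M : Type v} [AddCommGroup M] [Module R M]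
    {N : Type (max u v)} [AddCommGroup N] [Module R N] (e : M ≃ₗ[R] N) :
    IsDingProjective R M ↔ HasProjectiveChain R N := by
  constructor
  · rintro ⟨P, hP, hex, ⟨e₀⟩, hG⟩
    refine ⟨fun i => ModuleCat.of R (LinearMap.ker (P.d i)), ⟨e.symm.trans e₀⟩, fun i => ?_⟩
    -- Hom-exactness at index k extends maps from the kernel in degree k + 2; this form of the index
    -- avoids transport between terms.
    obtain ⟨k, rfl⟩ : ∃ k, i = k + 1 + 1 := ⟨i - 1 - 1, by ring⟩
    change ProjectiveLink R (LinearMap.ker (P.d (k + 1 + 1))) (LinearMap.ker (P.d (k + 1 + 1 + 1)))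
    let q (i : ℤ) : P.X i →ₗ[R] LinearMap.ker (P.d (i + 1)) :=
      (P.d i).codRestrict _ fun x => (hex i).apply_apply_eq_zero x
    have hq (i : ℤ) : Function.Surjective (q i) := fun y =>
      let ⟨x, hx⟩ := (hex i y).1 y.2
      ⟨x, Subtype.ext hx⟩
    refine ⟨P.X (k + 1 + 1), inferInstance, inferInstance, Submodule.subtype _, q _, hP _,
      Submodule.injective_subtype _, fun x => ?_, hq _, fun G _ _ hGf f => ?_⟩
    · rw [Set.mem_range]
      exact ⟨fun h => ⟨⟨x, congrArg Subtype.val h⟩, rfl⟩,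
        fun ⟨y, hy⟩ => Subtype.ext (by subst hy; exact y.2)⟩
    · obtain ⟨g, hg⟩ := (hG G hGf k (f ∘ₗ q (k + 1))).1 <| LinearMap.ext fun x => by
        have : q (k + 1) (P.d k x) = 0 := Subtype.ext ((hex k).apply_apply_eq_zero x)
        simp [this]
      refine ⟨g, fun x => ?_⟩
      obtain ⟨y, rfl⟩ := hq _ x
      exact LinearMap.congr_fun hg y
  · rintro ⟨Z, ⟨e₀⟩, hZ⟩
    choose P _ _ ι p hP hι hιp hp hG using hZ
    refine ⟨⟨P, fun i => ι (i + 1) ∘ₗ p i⟩, hP, fun i x => ?_, ⟨?_⟩, fun G _ _ hGf i y => ?_⟩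
    · have := hιp (i + 1) x
      simp only [LinearMap.comp_apply, map_eq_zero_iff _ (hι _), this, Set.mem_range]
      exact (hp i).exists
    · refine (e.trans e₀).trans ((LinearEquiv.ofInjective _ (hι 0)).trans (.ofEq _ _ ?_))
      ext x
      have := hιp 0 x
      simp only [LinearMap.mem_ker, LinearMap.comp_apply, map_eq_zero_iff _ (hι _), this]
      rfl
    · constructor
      · intro h
        obtain ⟨z, hz⟩ := LinearMap.exists_factor_of_surjective (hp (i + 1)) y fun a ha => by
          obtain ⟨b, rfl⟩ := (hιp _ a).1 ha
          obtain ⟨c, rfl⟩ := hp i b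
          exact LinearMap.congr_fun h c
        obtain ⟨g, hg⟩ := hG _ G hGf z
        exact ⟨g, LinearMap.ext fun a => (hg _).trans (hz a)⟩
      · rintro ⟨g, rfl⟩
        ext a
        simp [(hιp _).apply_apply_eq_zero]

end Chain

/-! ### Elements of the triangular ring -/

namespace TriangularRing

variable {R : Type u} [Ring R]

/-- The lower triangular matrix with rows `(a, 0)` and `(c, b)`. -/
def mk (a c b : R) : TriangularRing R :=
  ⟨!![a, 0; c, b], show (!![a, 0; c, b] : Matrix (Fin 2) (Fin 2) R) 0 1 = 0 by simp⟩

theorem mk_eta (A : TriangularRing R) : mk (A.1 0 0) (A.1 1 0) (A.1 1 1) = A := by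
  have hA : A.1 0 1 = 0 := A.2
  refine Subtype.ext ?_
  ext i j
  fin_cases i <;> fin_cases j <;> simp [mk, hA]

@[simp] theorem mk_val_zero_zero (a c b : R) : (mk a c b).1 0 0 = a := rfl
@[simp] theorem mk_val_one_zero (a c b : R) : (mk a c b).1 1 0 = c := rfl
@[simp] theorem mk_val_one_one (a c b : R) : (mk a c b).1 1 1 = b := rfl

theorem mk_mul_mk (a c b a' c' b' : R) :
    mk a c b * mk a' c' b' = mk (a * a') (c * a' + b * c') (b * b') := by
  refine Subtype.ext ?_
  change !![a, 0; c, b] * !![a', 0; c', b'] = !![a * a', 0; c * a' + b * c', b * b']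
  simp

theorem mk_add_mk (a c b a' c' b' : R) :
    mk a c b + mk a' c' b' = mk (a + a') (c + c') (b + b') := by
  refine Subtype.ext ?_
  change !![a, 0; c, b] + !![a', 0; c', b'] = !![a + a', 0; c + c', b + b']
  simp

theorem mk_one_zero_one : mk (1 : R) 0 1 = 1 := by
  refine Subtype.ext ?_
  exact Matrix.one_fin_two.symm

theorem mk_zero : mk (0 : R) 0 0 = 0 := by
  refine Subtype.ext ?_
  ext i j
  fin_cases i <;> fin_cases j <;> rfl

/-- The entry in the upper left corner, as a ring homomorphism. -/
def topLeft : TriangularRing R →+* R where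
  toFun A := A.1 0 0
  map_one' := rfl
  map_mul' A B := by
    have hA : A.1 0 1 = 0 := A.2
    change (A.1 * B.1) 0 0 = _
    simp [Matrix.mul_apply, Fin.sum_univ_two, hA]
  map_zero' := rfl
  map_add' _ _ := rfl

/-- The diagonal embedding. -/
def diag : R →+* TriangularRing R where
  toFun r := mk r 0 r
  map_one' := mk_one_zero_one
  map_mul' r s := by simp [mk_mul_mk]
  map_zero' := mk_zero
  map_add' r s := by simp [mk_add_mk]

theorem diag_apply (r : R) : diag r = mk r 0 r := rfl

theorem mul_apply_zero_zero (A B : TriangularRing R) : (A * B).1 0 0 = A.1 0 0 * B.1 0 0 :=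
  map_mul topLeft A B

theorem mul_apply_one_one (A B : TriangularRing R) : (A * B).1 1 1 = A.1 1 1 * B.1 1 1 := by
  have hB : B.1 0 1 = 0 := B.2
  change (A.1 * B.1) 1 1 = _
  simp [Matrix.mul_apply, Fin.sum_univ_two, hB]

theorem mul_apply_one_zero (A B : TriangularRing R) :
    (A * B).1 1 0 = A.1 1 0 * B.1 0 0 + A.1 1 1 * B.1 1 0 := by
  change (A.1 * B.1) 1 0 = _
  simp [Matrix.mul_apply, Fin.sum_univ_two]

end TriangularRing

/-! ### Homomorphisms between triples -/

namespace TripleModule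

open TriangularRing

variable {R : Type u} [Ring R]

section

variable {M₁ M₂ : Type v} [AddCommGroup M₁] [AddCommGroup M₂]
  [Module R M₁] [Module R M₂] {φ : M₁ →ₗ[R] M₂}

variable (φ) in
/-- The element of a triple module with the given components. -/
def mk (x : M₁) (y : M₂) : TripleModule φ := (x, y)

@[elab_as_elim]
theorem ind {motive : TripleModule φ → Prop} (h : ∀ x y, motive (mk φ x y)) (m) : motive m :=
  h m.1 m.2

@[simp] theorem mk_fst (x : M₁) (y : M₂) : (mk φ x y).1 = x := rfl
@[simp] theorem mk_snd (x : M₁) (y : M₂) : (mk φ x y).2 = y := rfl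

theorem mk_inj {x x' : M₁} {y y' : M₂} : mk φ x y = mk φ x' y' ↔ x = x' ∧ y = y' :=
  Prod.mk_inj

theorem mk_eq_zero {x : M₁} {y : M₂} : mk φ x y = 0 ↔ x = 0 ∧ y = 0 :=
  Prod.mk_eq_zero

theorem mk_add_mk (x x' : M₁) (y y' : M₂) : mk φ x y + mk φ x' y' = mk φ (x + x') (y + y') := rfl

theorem smul_mk (A : TriangularRing R) (x : M₁) (y : M₂) :
    A • mk φ x y = mk φ (A.1 0 0 • x) (A.1 1 0 • φ x + A.1 1 1 • y) := rfl

theorem mk_eq_add (x : M₁) (y : M₂) : mk φ x y = mk φ x 0 + mk φ 0 y := by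
  simp [mk_add_mk]

end

section Map

variable {M₁ M₂ : Type v} [AddCommGroup M₁] [AddCommGroup M₂]
  [Module R M₁] [Module R M₂] {φ : M₁ →ₗ[R] M₂}
  {N₁ N₂ : Type w} [AddCommGroup N₁] [AddCommGroup N₂]
  [Module R N₁] [Module R N₂] {ψ : N₁ →ₗ[R] N₂}

/-- The homomorphism of triples given by a commutative square. -/
def map (f₁ : M₁ →ₗ[R] N₁) (f₂ : M₂ →ₗ[R] N₂) (h : ∀ x, f₂ (φ x) = ψ (f₁ x)) :
    TripleModule φ →ₗ[TriangularRing R] TripleModule ψ where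
  toFun m := mk ψ (f₁ m.1) (f₂ m.2)
  map_add' m n := by
    induction m using ind
    induction n using ind
    simp [mk_add_mk]
  map_smul' A m := by
    induction m using ind
    simp [smul_mk, h]

@[simp] theorem map_mk (f₁ : M₁ →ₗ[R] N₁) (f₂ : M₂ →ₗ[R] N₂) (h : ∀ x, f₂ (φ x) = ψ (f₁ x))
    (x : M₁) (y : M₂) : map f₁ f₂ h (mk φ x y) = mk ψ (f₁ x) (f₂ y) := rfl

/-- Linearity over the diagonal idempotents forces F to respect the components; linearity over the
matrix unit e₂₁, which acts as φ and ψ, gives the commuting square. -/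
theorem exists_eq_map (F : TripleModule φ →ₗ[TriangularRing R] TripleModule ψ) :
    ∃ (f₁ : M₁ →ₗ[R] N₁) (f₂ : M₂ →ₗ[R] N₂) (h : ∀ x, f₂ (φ x) = ψ (f₁ x)), F = map f₁ f₂ h := by
  have h₁ (x : M₁) : F (mk φ x 0) = mk ψ (F (mk φ x 0)).1 0 := by
    have := F.map_smul (TriangularRing.mk (1 : R) 0 0) (mk φ x 0)
    simp only [smul_mk] at this
    simp only [mk_val_zero_zero, mk_val_one_zero, mk_val_one_one, one_smul, zero_smul,
      add_zero] at this
    rw [this]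
    induction F (mk φ x 0) using ind
    simp [smul_mk]
  have h₂ (y : M₂) : F (mk φ 0 y) = mk ψ 0 (F (mk φ 0 y)).2 := by
    have := F.map_smul (TriangularRing.mk (0 : R) 0 1) (mk φ 0 y)
    simp only [smul_mk] at this
    simp only [mk_val_zero_zero, mk_val_one_zero, mk_val_one_one, one_smul, zero_smul,
      zero_add] at this
    rw [this]
    induction F (mk φ 0 y) using ind
    simp [smul_mk]
  let f₁ : M₁ →ₗ[R] N₁ :=
    { toFun := fun x => (F (mk φ x 0)).1
      map_add' := fun x x' => by
        rw [show mk φ (x + x') 0 = mk φ x 0 + mk φ x' 0 by simp [mk_add_mk], map_add]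
        rfl
      map_smul' := fun r x => by
        rw [show mk φ (r • x) 0 = TriangularRing.mk r 0 0 • mk φ x 0 by simp [smul_mk],
          F.map_smul]
        rfl }
  let f₂ : M₂ →ₗ[R] N₂ :=
    { toFun := fun y => (F (mk φ 0 y)).2
      map_add' := fun y y' => by
        rw [show mk φ 0 (y + y') = mk φ 0 y + mk φ 0 y' by simp [mk_add_mk], map_add]
        rfl
      map_smul' := fun r y => by
        rw [show mk φ 0 (r • y) = TriangularRing.mk 0 0 r • mk φ 0 y by simp [smul_mk],
          F.map_smul, h₂]
        simp [smul_mk] }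
  refine ⟨f₁, f₂, fun x => ?_, LinearMap.ext fun m => ?_⟩
  · change (F (mk φ 0 (φ x))).2 = ψ (F (mk φ x 0)).1
    rw [show mk φ 0 (φ x) = TriangularRing.mk (0 : R) 1 0 • mk φ x 0 by simp [smul_mk], F.map_smul, h₁]
    simp [smul_mk]
  · induction m using ind with | _ x y
    rw [mk_eq_add, map_add, h₁, h₂, mk_add_mk, add_zero, zero_add, ← mk_eq_add]
    rfl

/-- The isomorphism of triples given by a commutative square of isomorphisms. -/
def equiv (e₁ : M₁ ≃ₗ[R] N₁) (e₂ : M₂ ≃ₗ[R] N₂) (h : ∀ x, e₂ (φ x) = ψ (e₁ x)) :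
    TripleModule φ ≃ₗ[TriangularRing R] TripleModule ψ :=
  .ofLinearMap (map e₁.toLinearMap e₂.toLinearMap h)
    (map e₁.symm.toLinearMap e₂.symm.toLinearMap fun y => by
      apply e₂.injective; simp [h])
    (LinearMap.ext fun m => by induction m using ind; simp)
    (LinearMap.ext fun m => by induction m using ind; simp)

variable {f₁ : M₁ →ₗ[R] N₁} {f₂ : M₂ →ₗ[R] N₂} {h : ∀ x, f₂ (φ x) = ψ (f₁ x)}

theorem map_injective_iff :
    Function.Injective (map f₁ f₂ h) ↔ Function.Injective f₁ ∧ Function.Injective f₂ :=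
  Prod.map_injective

theorem map_surjective_iff :
    Function.Surjective (map f₁ f₂ h) ↔ Function.Surjective f₁ ∧ Function.Surjective f₂ :=
  Prod.map_surjective

theorem map_exact_iff {K₁ K₂ : Type v'} [AddCommGroup K₁] [AddCommGroup K₂] [Module R K₁]
    [Module R K₂] {κ : K₁ →ₗ[R] K₂} {g₁ : N₁ →ₗ[R] K₁} {g₂ : N₂ →ₗ[R] K₂}
    {h' : ∀ x, g₂ (ψ x) = κ (g₁ x)} :
    Function.Exact (map f₁ f₂ h) (map g₁ g₂ h') ↔ Function.Exact f₁ g₁ ∧ Function.Exact f₂ g₂ := by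
  have key (x : N₁) (y : N₂) : mk ψ x y ∈ Set.range (map f₁ f₂ h) ↔
      x ∈ Set.range f₁ ∧ y ∈ Set.range f₂ := by
    constructor
    · rintro ⟨m, hm⟩
      obtain ⟨rfl, rfl⟩ := mk_inj.1 hm
      exact ⟨⟨_, rfl⟩, ⟨_, rfl⟩⟩
    · rintro ⟨⟨a, rfl⟩, ⟨b, rfl⟩⟩
      exact ⟨mk φ a b, rfl⟩
  constructor
  · refine fun H => ⟨fun x => ?_, fun y => ?_⟩
    · have := H (mk ψ x 0)
      rwa [key, map_mk, mk_eq_zero, and_iff_left (map_zero _), and_iff_left ⟨0, map_zero _⟩] at this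
    · have := H (mk ψ 0 y)
      rwa [key, map_mk, mk_eq_zero, and_iff_right (map_zero _),
        and_iff_right ⟨0, map_zero _⟩] at this
  · rintro ⟨H₁, H₂⟩ m
    induction m using ind
    rw [key, map_mk, mk_eq_zero, H₁ _, H₂ _]

end Map

end TripleModule

/-! ### Every module over the triangular ring is a triple -/

namespace TriangularRing

variable {R : Type u} [Ring R] (P : Type w) [AddCommGroup P] [Module (TriangularRing R) P]

/-- The first component of a module over the triangular ring. -/
def Top : AddSubgroup P where
  carrier := {x | (mk 1 0 0 : TriangularRing R) • x = x}
  add_mem' {x y} hx hy := by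
    simp only [Set.mem_ofPred_eq] at hx hy ⊢
    rw [smul_add, hx, hy]
  zero_mem' := smul_zero _
  neg_mem' {x} hx := by
    simp only [Set.mem_ofPred_eq] at hx ⊢
    rw [smul_neg, hx]

/-- The second component of a module over the triangular ring. -/
def Bot : AddSubgroup P where
  carrier := {x | (mk 0 0 1 : TriangularRing R) • x = x}
  add_mem' {x y} hx hy := by
    simp only [Set.mem_ofPred_eq] at hx hy ⊢
    rw [smul_add, hx, hy]
  zero_mem' := smul_zero _
  neg_mem' {x} hx := by
    simp only [Set.mem_ofPred_eq] at hx ⊢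
    rw [smul_neg, hx]

variable {P} in
theorem mem_top {x : P} : x ∈ Top (R := R) P ↔ (mk 1 0 0 : TriangularRing R) • x = x := Iff.rfl

variable {P} in
theorem mem_bot {x : P} : x ∈ Bot (R := R) P ↔ (mk 0 0 1 : TriangularRing R) • x = x := Iff.rfl

instance : Module R (Top (R := R) P) where
  smul r x := ⟨mk r 0 0 • x.1, by simp [mem_top, smul_smul, mk_mul_mk]⟩
  one_smul x := Subtype.ext x.2
  mul_smul r s x := Subtype.ext <| by
    change mk (r * s) 0 0 • x.1 = mk r 0 0 • mk s 0 0 • x.1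
    simp [smul_smul, mk_mul_mk]
  smul_zero r := Subtype.ext (smul_zero (mk r 0 0))
  smul_add r x y := Subtype.ext (smul_add (mk r 0 0) x.1 y.1)
  add_smul r s x := Subtype.ext <| by
    change mk (r + s) 0 0 • x.1 = mk r 0 0 • x.1 + mk s 0 0 • x.1
    simp [← add_smul, mk_add_mk]
  zero_smul x := Subtype.ext <| by
    change mk (0 : R) 0 0 • x.1 = 0
    simp [mk_zero]

instance : Module R (Bot (R := R) P) where
  smul r x := ⟨mk 0 0 r • x.1, by simp [mem_bot, smul_smul, mk_mul_mk]⟩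
  one_smul x := Subtype.ext x.2
  mul_smul r s x := Subtype.ext <| by
    change mk 0 0 (r * s) • x.1 = mk 0 0 r • mk 0 0 s • x.1
    simp [smul_smul, mk_mul_mk]
  smul_zero r := Subtype.ext (smul_zero (mk 0 0 r))
  smul_add r x y := Subtype.ext (smul_add (mk 0 0 r) x.1 y.1)
  add_smul r s x := Subtype.ext <| by
    change mk 0 0 (r + s) • x.1 = mk 0 0 r • x.1 + mk 0 0 s • x.1
    simp [← add_smul, mk_add_mk]
  zero_smul x := Subtype.ext <| by
    change mk (0 : R) 0 0 • x.1 = 0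
    simp [mk_zero]

theorem coe_smul_top (r : R) (x : Top (R := R) P) : ((r • x : Top (R := R) P) : P) =
    mk r 0 0 • (x : P) := rfl

theorem coe_smul_bot (r : R) (x : Bot (R := R) P) : ((r • x : Bot (R := R) P) : P) =
    mk 0 0 r • (x : P) := rfl

/-- The structure homomorphism between the components of a module over the triangular ring. -/
def structureMap : Top (R := R) P →ₗ[R] Bot (R := R) P where
  toFun x := ⟨mk (0 : R) 1 0 • x.1, by simp [mem_bot, smul_smul, mk_mul_mk]⟩
  map_add' x y := Subtype.ext (smul_add (mk (0 : R) 1 0) x.1 y.1)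
  map_smul' r x := Subtype.ext <| by simp [coe_smul_top, coe_smul_bot, smul_smul, mk_mul_mk]

/-- A module over the triangular ring is the triple formed by its components. -/
def equivTriple : P ≃ₗ[TriangularRing R] TripleModule (structureMap (R := R) P) where
  toFun x := TripleModule.mk _ ⟨mk (1 : R) 0 0 • x, by simp [mem_top, smul_smul, mk_mul_mk]⟩
    ⟨mk (0 : R) 0 1 • x, by simp [mem_bot, smul_smul, mk_mul_mk]⟩
  invFun m := m.1.1 + m.2.1
  map_add' x y := by
    rw [TripleModule.mk_add_mk, TripleModule.mk_inj]
    exact ⟨Subtype.ext (smul_add _ _ _), Subtype.ext (smul_add _ _ _)⟩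
  map_smul' A x := by
    rw [← mk_eta A, RingHom.id_apply, TripleModule.smul_mk, TripleModule.mk_inj]
    refine ⟨Subtype.ext ?_, Subtype.ext ?_⟩
    · simp [coe_smul_top, smul_smul, mk_mul_mk]
    · simp [coe_smul_bot, structureMap, smul_smul, mk_mul_mk, ← add_smul, mk_add_mk]
  left_inv x := by
    change mk (1 : R) 0 0 • x + mk (0 : R) 0 1 • x = x
    simp [← add_smul, mk_add_mk, mk_one_zero_one]
  right_inv m := by
    induction m using TripleModule.ind with | _ x y
    have hx := mem_top.1 x.2
    have hy := mem_bot.1 y.2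
    refine TripleModule.mk_inj.2 ⟨Subtype.ext ?_, Subtype.ext ?_⟩
    · change mk (1 : R) 0 0 • (x.1 + y.1) = x.1
      rw [smul_add, hx, ← hy]
      simp [smul_smul, mk_mul_mk, mk_zero]
    · change mk (0 : R) 0 1 • (x.1 + y.1) = y.1
      rw [smul_add, hy, ← hx]
      simp [smul_smul, mk_mul_mk, mk_zero]

theorem exists_equiv_triple : ∃ (P₁ P₂ : Type w) (_ : AddCommGroup P₁) (_ : AddCommGroup P₂)
    (_ : Module R P₁) (_ : Module R P₂) (ρ : P₁ →ₗ[R] P₂),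
    Nonempty (P ≃ₗ[TriangularRing R] TripleModule ρ) :=
  ⟨_, _, _, _, _, _, structureMap P, ⟨equivTriple P⟩⟩

end TriangularRing

/-! ### Flat triples -/

section RestrictRight

variable {R S : Type u} [Ring R] [Ring S]

/-- The restriction of scalars of a right module along a ring homomorphism. -/
def RestrictRight (_σ : R →+* S) (N : Type w) : Type w := N

namespace RestrictRight

variable (σ : R →+* S) {N N' : Type w} [AddCommGroup N] [Module Sᵐᵒᵖ N] [AddCommGroup N']
  [Module Sᵐᵒᵖ N']

instance : AddCommGroup (RestrictRight σ N) := inferInstanceAs (AddCommGroup N)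

instance : Module Rᵐᵒᵖ (RestrictRight σ N) :=
  letI : Module Rᵐᵒᵖ N := Module.compHom N (RingHom.op σ)
  inferInstanceAs (Module Rᵐᵒᵖ N)

/-- The identity map to the restriction of scalars. -/
def of : N ≃+ RestrictRight σ N := AddEquiv.refl N

theorem smul_of (r : R) (n : N) :
    MulOpposite.op r • of σ n = of σ (MulOpposite.op (σ r) • n) := rfl

/-- The restriction of scalars of a homomorphism. -/
def map (f : N →ₗ[Sᵐᵒᵖ] N') : RestrictRight σ N →ₗ[Rᵐᵒᵖ] RestrictRight σ N' where
  toFun n := of σ (f ((of σ).symm n))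
  map_add' m n := by simp
  map_smul' r n := congrArg (of σ) (f.map_smul (RingHom.op σ r) ((of σ).symm n))

@[simp] theorem map_of (f : N →ₗ[Sᵐᵒᵖ] N') (n : N) : map σ f (of σ n) = of σ (f n) := rfl

theorem map_injective {f : N →ₗ[Sᵐᵒᵖ] N'} (hf : Function.Injective f) :
    Function.Injective (map σ f) := hf

end RestrictRight

end RestrictRight

section FlatTriple

open TripleModule BalancedTensor

variable {R : Type u} [Ring R]

/-- (G, G, id) is T e₁₁ ⊗_R G, so tensoring N with it gives N e₁₁ ⊗_R G, a natural summand of N ⊗_R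
G for N restricted along the diagonal. Hence the formula n ⊗ (x, y) ↦ n e₁₁ ⊗ x + n e₂₁ ⊗ y. -/
theorem IsFlatModule.triple_id {G : Type v} [AddCommGroup G] [Module R G]
    (hG : IsFlatModule R G) :
    IsFlatModule (TriangularRing R) (TripleModule (LinearMap.id : G →ₗ[R] G)) := by
  intro N N' _ _ _ _ f hf
  let σ : R →+* TriangularRing R := TriangularRing.diag
  let a (N : Type u) [AddCommGroup N] [Module (TriangularRing R)ᵐᵒᵖ N] :
      BalancedTensor (TriangularRing R) N (TripleModule (LinearMap.id : G →ₗ[R] G)) →+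
        BalancedTensor R (RestrictRight σ N) G :=
    lift (fun n m =>
      tmul R (RestrictRight.of σ (MulOpposite.op (TriangularRing.mk (1 : R) 0 0) • n)) m.1 +
        tmul R (RestrictRight.of σ (MulOpposite.op (TriangularRing.mk (0 : R) 1 0) • n)) m.2)
      (fun n m m' => by
        cases m using ind
        cases m' using ind
        rw [TripleModule.mk_add_mk]
        simp only [mk_fst, mk_snd, tmul_add]
        abel)
      (fun n n' m => by
        simp only [smul_add, map_add, add_tmul]
        abel)
      (fun n A m => by
        cases m using ind with | _ x y
        rw [← TriangularRing.mk_eta A]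
        generalize A.1 0 0 = p, A.1 1 0 = q, A.1 1 1 = r
        have h (s : R) (B : TriangularRing R) (z : G) :
            tmul R (RestrictRight.of σ (MulOpposite.op B • n)) (s • z) =
              tmul R (RestrictRight.of σ (MulOpposite.op (B * σ s) • n)) z := by
          rw [← smul_tmul, RestrictRight.smul_of, smul_smul, ← MulOpposite.op_mul]
        rw [TripleModule.smul_mk]
        simp only [mk_fst, mk_snd, smul_smul, ← MulOpposite.op_mul, tmul_add,
          TriangularRing.mk_val_zero_zero, TriangularRing.mk_val_one_zero,
          TriangularRing.mk_val_one_one, h]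
        rw [← add_assoc]
        simp only [LinearMap.id_apply, σ, TriangularRing.diag_apply, TriangularRing.mk_mul_mk]
        rw [← add_tmul, ← map_add, ← add_smul, ← MulOpposite.op_add]
        simp [TriangularRing.mk_add_mk])
  let b : BalancedTensor R (RestrictRight σ N) G →+
      BalancedTensor (TriangularRing R) N (TripleModule (LinearMap.id : G →ₗ[R] G)) :=
    lift (fun n x => tmul _ ((RestrictRight.of σ).symm n) (TripleModule.mk (LinearMap.id : G →ₗ[R] G) x 0))
      (fun n x x' => by rw [← tmul_add, TripleModule.mk_add_mk, add_zero])
      (fun n n' x => by rw [map_add, add_tmul])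
      (fun n r x => by
        obtain ⟨n, rfl⟩ := (RestrictRight.of σ).surjective n
        rw [RestrictRight.smul_of, AddEquiv.symm_apply_apply, AddEquiv.symm_apply_apply, smul_tmul]
        simp [σ, TripleModule.smul_mk, TriangularRing.diag_apply])
  refine (hG _ _ (RestrictRight.map σ f) (RestrictRight.map_injective σ hf)).of_retract
    (a N) (a N') b (fun t => ?_) fun t => ?_
  · refine DFunLike.congr_fun (f := b.comp (a N)) (g := .id _) (hom_ext fun n m => ?_) t
    cases m using ind with | _ x y
    simp only [AddMonoidHom.comp_apply, a, b, lift_tmul, map_add, AddMonoidHom.id_apply,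
      AddEquiv.symm_apply_apply, smul_tmul, ← tmul_add]
    simp [TripleModule.smul_mk, TripleModule.mk_add_mk]
  · refine DFunLike.congr_fun (f := (a N').comp (BalancedTensor.map (TriangularRing R) _ f))
      (g := (BalancedTensor.map R G (RestrictRight.map σ f)).comp (a N))
      (hom_ext fun n m => ?_) t
    simp [a]

/-- The same argument with T e₂₂ ⊗_R G = (0, G, 0), where N ⊗ (0, G, 0) is N e₂₂ ⊗_R G. -/
theorem IsFlatModule.triple_zero {G : Type v} [AddCommGroup G] [Module R G]
    (hG : IsFlatModule R G) :
    IsFlatModule (TriangularRing R) (TripleModule (0 : PUnit.{v + 1} →ₗ[R] G)) := by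
  intro N N' _ _ _ _ f hf
  let σ : R →+* TriangularRing R := TriangularRing.diag
  let a (N : Type u) [AddCommGroup N] [Module (TriangularRing R)ᵐᵒᵖ N] :
      BalancedTensor (TriangularRing R) N (TripleModule (0 : PUnit.{v + 1} →ₗ[R] G)) →+
        BalancedTensor R (RestrictRight σ N) G :=
    lift (fun n m =>
      tmul R (RestrictRight.of σ (MulOpposite.op (TriangularRing.mk (0 : R) 0 1) • n)) m.2)
      (fun n m m' => tmul_add _ _ _)
      (fun n n' m => by simp only [smul_add, map_add, add_tmul])
      (fun n A m => by
        cases m using ind with | _ x y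
        rw [← TriangularRing.mk_eta A]
        generalize A.1 0 0 = p, A.1 1 0 = q, A.1 1 1 = r
        rw [TripleModule.smul_mk]
        simp only [mk_snd, TriangularRing.mk_val_one_one, LinearMap.zero_apply, smul_zero,
          zero_add]
        rw [← smul_tmul, RestrictRight.smul_of, smul_smul, smul_smul, ← MulOpposite.op_mul,
          ← MulOpposite.op_mul]
        simp [σ, TriangularRing.diag_apply, TriangularRing.mk_mul_mk])
  let b : BalancedTensor R (RestrictRight σ N) G →+
      BalancedTensor (TriangularRing R) N (TripleModule (0 : PUnit.{v + 1} →ₗ[R] G)) :=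
    lift (fun n x => tmul _ ((RestrictRight.of σ).symm n) (TripleModule.mk (0 : PUnit.{v + 1} →ₗ[R] G) 0 x))
      (fun n x x' => by rw [← tmul_add, TripleModule.mk_add_mk, add_zero])
      (fun n n' x => by rw [map_add, add_tmul])
      (fun n r x => by
        obtain ⟨n, rfl⟩ := (RestrictRight.of σ).surjective n
        rw [RestrictRight.smul_of, AddEquiv.symm_apply_apply, AddEquiv.symm_apply_apply, smul_tmul]
        simp [σ, TripleModule.smul_mk, TriangularRing.diag_apply])
  refine (hG _ _ (RestrictRight.map σ f) (RestrictRight.map_injective σ hf)).of_retract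
    (a N) (a N') b (fun t => ?_) fun t => ?_
  · refine DFunLike.congr_fun (f := b.comp (a N)) (g := .id _) (hom_ext fun n m => ?_) t
    cases m using ind with | _ x y
    change tmul _ (MulOpposite.op (TriangularRing.mk (0 : R) 0 1) • n)
      (TripleModule.mk (0 : PUnit.{v + 1} →ₗ[R] G) 0 y) = tmul _ n (TripleModule.mk _ x y)
    rw [smul_tmul, TripleModule.smul_mk]
    simp [Subsingleton.elim x 0]
  · refine DFunLike.congr_fun (f := (a N').comp (BalancedTensor.map (TriangularRing R) _ f))
      (g := (BalancedTensor.map R G (RestrictRight.map σ f)).comp (a N))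
      (hom_ext fun n m => ?_) t
    change tmul R (RestrictRight.of σ (MulOpposite.op (TriangularRing.mk (0 : R) 0 1) • f n)) m.2 =
      tmul R (RestrictRight.of σ (f (MulOpposite.op (TriangularRing.mk (0 : R) 0 1) • n))) m.2
    rw [f.map_smul]

variable {G₁ G₂ : Type v} [AddCommGroup G₁] [AddCommGroup G₂] [Module R G₁] [Module R G₂]
  {γ : G₁ →ₗ[R] G₂}

/-- A right R-module N becomes a T(R)-module through the upper left entry, and tensoring it with the
triple returns N ⊗_R G₁. -/
theorem IsFlatModule.fst_of_triple (hG : IsFlatModule (TriangularRing R) (TripleModule γ)) :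
    IsFlatModule R G₁ := by
  intro N N' _ _ _ _ f hf
  let σ : TriangularRing R →+* R := TriangularRing.topLeft
  let a (N : Type u) [AddCommGroup N] [Module Rᵐᵒᵖ N] : BalancedTensor R N G₁ →+
      BalancedTensor (TriangularRing R) (RestrictRight σ N) (TripleModule γ) :=
    lift (fun n x => tmul _ (RestrictRight.of σ n) (TripleModule.mk γ x 0))
      (fun n x x' => by rw [← tmul_add, TripleModule.mk_add_mk, add_zero])
      (fun n n' x => by rw [map_add, add_tmul])
      (fun n r x => by
        have := smul_tmul (TriangularRing.mk r 0 0) (RestrictRight.of σ n) (TripleModule.mk γ x 0)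
        rw [TripleModule.smul_mk, RestrictRight.smul_of] at this
        simpa [show σ (TriangularRing.mk r 0 0) = r from rfl] using this)
  let b : BalancedTensor (TriangularRing R) (RestrictRight σ N) (TripleModule γ) →+
      BalancedTensor R N G₁ :=
    lift (fun n m => tmul R ((RestrictRight.of σ).symm n) m.1)
      (fun n m m' => tmul_add _ _ _)
      (fun n n' m => by rw [map_add, add_tmul])
      (fun n A m => smul_tmul (A.1 0 0) ((RestrictRight.of σ).symm n) m.1)
  refine (hG _ _ (RestrictRight.map σ f) (RestrictRight.map_injective σ hf)).of_retract
    (a N) (a N') b (fun t => ?_) fun t => ?_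
  · refine DFunLike.congr_fun (f := b.comp (a N)) (g := .id _) (hom_ext fun n m => ?_) t
    rfl
  · refine DFunLike.congr_fun (f := (a N').comp (BalancedTensor.map R _ f))
      (g := (BalancedTensor.map (TriangularRing R) _ (RestrictRight.map σ f)).comp (a N))
      (hom_ext fun n m => ?_) t
    simp [a]

/-- The rows of length two with entries in a right `R`-module. -/
def RowModule (N : Type w) : Type w := N × N

namespace RowModule

variable {N : Type w} [AddCommGroup N] [Module Rᵐᵒᵖ N]

instance : AddCommGroup (RowModule N) := inferInstanceAs (AddCommGroup (N × N))

instance : Module (TriangularRing R)ᵐᵒᵖ (RowModule N) where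
  smul A n := (MulOpposite.op (A.unop.1 0 0) • n.1 + MulOpposite.op (A.unop.1 1 0) • n.2,
    MulOpposite.op (A.unop.1 1 1) • n.2)
  one_smul n := by
    refine Prod.ext ?_ ?_
    · change MulOpposite.op ((1 : Matrix (Fin 2) (Fin 2) R) 0 0) • n.1 +
        MulOpposite.op ((1 : Matrix (Fin 2) (Fin 2) R) 1 0) • n.2 = n.1
      simp
    · change MulOpposite.op ((1 : Matrix (Fin 2) (Fin 2) R) 1 1) • n.2 = n.2
      simp
  mul_smul A B n := by
    refine Prod.ext ?_ ?_
    · change MulOpposite.op ((B.unop * A.unop).1 0 0) • n.1 +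
        MulOpposite.op ((B.unop * A.unop).1 1 0) • n.2 =
        MulOpposite.op (A.unop.1 0 0) • (MulOpposite.op (B.unop.1 0 0) • n.1 +
          MulOpposite.op (B.unop.1 1 0) • n.2) +
          MulOpposite.op (A.unop.1 1 0) • MulOpposite.op (B.unop.1 1 1) • n.2
      simp [TriangularRing.mul_apply_zero_zero, TriangularRing.mul_apply_one_zero, mul_smul, add_smul, add_assoc]
    · change MulOpposite.op ((B.unop * A.unop).1 1 1) • n.2 =
        MulOpposite.op (A.unop.1 1 1) • MulOpposite.op (B.unop.1 1 1) • n.2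
      simp [TriangularRing.mul_apply_one_one, mul_smul]
  smul_zero A := by
    refine Prod.ext ?_ ?_
    · change MulOpposite.op (A.unop.1 0 0) • (0 : N) + MulOpposite.op (A.unop.1 1 0) • (0 : N) = 0
      simp
    · change MulOpposite.op (A.unop.1 1 1) • (0 : N) = 0
      simp
  smul_add A m n := by
    refine Prod.ext ?_ ?_
    · change MulOpposite.op (A.unop.1 0 0) • (m.1 + n.1) +
        MulOpposite.op (A.unop.1 1 0) • (m.2 + n.2) =
        (MulOpposite.op (A.unop.1 0 0) • m.1 + MulOpposite.op (A.unop.1 1 0) • m.2) +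
        (MulOpposite.op (A.unop.1 0 0) • n.1 + MulOpposite.op (A.unop.1 1 0) • n.2)
      simp only [smul_add]
      abel
    · exact smul_add (MulOpposite.op (A.unop.1 1 1)) m.2 n.2
  add_smul A B n := by
    refine Prod.ext ?_ ?_
    · change MulOpposite.op (A.unop.1 0 0 + B.unop.1 0 0) • n.1 +
        MulOpposite.op (A.unop.1 1 0 + B.unop.1 1 0) • n.2 =
        (MulOpposite.op (A.unop.1 0 0) • n.1 + MulOpposite.op (A.unop.1 1 0) • n.2) +
        (MulOpposite.op (B.unop.1 0 0) • n.1 + MulOpposite.op (B.unop.1 1 0) • n.2)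
      simp only [MulOpposite.op_add, add_smul]
      abel
    · exact add_smul (MulOpposite.op (A.unop.1 1 1)) (MulOpposite.op (B.unop.1 1 1)) n.2
  zero_smul n := by
    refine Prod.ext ?_ ?_
    · change MulOpposite.op (0 : R) • n.1 + MulOpposite.op (0 : R) • n.2 = 0
      simp
    · change MulOpposite.op (0 : R) • n.2 = 0
      simp

/-- The row with the given entries. -/
def mk (x y : N) : RowModule N := (x, y)

theorem smul_mk (A : TriangularRing R) (x y : N) : MulOpposite.op A • mk x y =
    mk (MulOpposite.op (A.1 0 0) • x + MulOpposite.op (A.1 1 0) • y)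
      (MulOpposite.op (A.1 1 1) • y) := rfl

theorem mk_add_mk (x y x' y' : N) : mk x y + mk x' y' = mk (x + x') (y + y') := rfl

/-- The entrywise application of a homomorphism. -/
def map {N' : Type w} [AddCommGroup N'] [Module Rᵐᵒᵖ N'] (f : N →ₗ[Rᵐᵒᵖ] N') :
    RowModule N →ₗ[(TriangularRing R)ᵐᵒᵖ] RowModule N' where
  toFun n := mk (f n.1) (f n.2)
  map_add' m n := by
    rw [mk_add_mk, ← map_add, ← map_add]
    rfl
  map_smul' A n := by
    change mk (f (MulOpposite.op (A.unop.1 0 0) • n.1 + MulOpposite.op (A.unop.1 1 0) • n.2))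
      (f (MulOpposite.op (A.unop.1 1 1) • n.2)) = MulOpposite.op A.unop • mk (f n.1) (f n.2)
    rw [smul_mk, map_add, map_smul, map_smul, map_smul]

theorem map_mk {N' : Type w} [AddCommGroup N'] [Module Rᵐᵒᵖ N'] (f : N →ₗ[Rᵐᵒᵖ] N') (x y : N) :
    map f (mk x y) = mk (f x) (f y) := rfl

end RowModule

/-- Restriction along the lower right entry would yield coker γ. The row module N ⊗_R e₂₂T is used
instead: its tensor product with the triple is N ⊗_R G₂, the first entry of a row pairing with G₁
through γ. -/
theorem IsFlatModule.snd_of_triple (hG : IsFlatModule (TriangularRing R) (TripleModule γ)) :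
    IsFlatModule R G₂ := by
  intro N N' _ _ _ _ f hf
  let a (N : Type u) [AddCommGroup N] [Module Rᵐᵒᵖ N] : BalancedTensor R N G₂ →+
      BalancedTensor (TriangularRing R) (RowModule N) (TripleModule γ) :=
    lift (fun n y => tmul _ (RowModule.mk 0 n) (TripleModule.mk γ 0 y))
      (fun n x x' => by rw [← tmul_add, TripleModule.mk_add_mk, add_zero])
      (fun n n' x => by rw [← add_tmul, RowModule.mk_add_mk, add_zero])
      (fun n r x => by
        have := smul_tmul (TriangularRing.mk 0 0 r) (RowModule.mk 0 n) (TripleModule.mk γ 0 x)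
        rw [TripleModule.smul_mk, RowModule.smul_mk] at this
        simpa using this)
  let b : BalancedTensor (TriangularRing R) (RowModule N) (TripleModule γ) →+
      BalancedTensor R N G₂ :=
    lift (fun n m => tmul R n.1 (γ m.1) + tmul R n.2 m.2)
      (fun n m m' => by
        cases m using ind
        cases m' using ind
        rw [TripleModule.mk_add_mk]
        simp only [mk_fst, mk_snd, map_add, tmul_add]
        abel)
      (fun n n' m => by
        change tmul R (n.1 + n'.1) (γ m.1) + tmul R (n.2 + n'.2) m.2 = _
        simp only [add_tmul]
        abel)
      (fun n A m => by
        change tmul R (MulOpposite.op (A.1 0 0) • n.1 + MulOpposite.op (A.1 1 0) • n.2) (γ m.1) +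
          tmul R (MulOpposite.op (A.1 1 1) • n.2) m.2 =
          tmul R n.1 (γ (A.1 0 0 • m.1)) + tmul R n.2 (A.1 1 0 • γ m.1 + A.1 1 1 • m.2)
        simp only [add_tmul, tmul_add, smul_tmul, map_smul]
        abel)
  have hb (x y : N) (m : TripleModule γ) : b (tmul _ (RowModule.mk x y) m) =
      tmul R x (γ m.1) + tmul R y m.2 := rfl
  have hinj : Function.Injective (RowModule.map f) := hf.prodMap hf
  refine (hG _ _ (RowModule.map f) hinj).of_retract (a N) (a N') b (fun t => ?_) fun t => ?_
  · refine DFunLike.congr_fun (f := b.comp (a N)) (g := .id _) (hom_ext fun n m => ?_) t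
    simp [a, hb, tmul_zero]
  · refine DFunLike.congr_fun (f := (a N').comp (BalancedTensor.map R _ f))
      (g := (BalancedTensor.map (TriangularRing R) _ (RowModule.map f)).comp (a N))
      (hom_ext fun n m => ?_) t
    simp [a, RowModule.map_mk]

end FlatTriple

/-! ### Projective triples -/

namespace TripleModule

variable {R : Type u} [Ring R]

/-- The triple is (P, P, id) ⊕ (0, Q, 0). A free cover is split by lifting on P and on Q separately;
the copy of P in the second component has its lift dictated by the square. -/
theorem projective_inl (P Q : Type v) [AddCommGroup P] [AddCommGroup Q] [Module R P] [Module R Q]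
    [Module.Projective R P] [Module.Projective R Q] :
    Module.Projective (TriangularRing R) (TripleModule (LinearMap.inl R P Q)) := by
  refine .of_lifting_property'' fun f hf => ?_
  obtain ⟨F₁, F₂, _, _, _, _, ρ, ⟨e⟩⟩ := TriangularRing.exists_equiv_triple (R := R)
    (TripleModule (LinearMap.inl R P Q) →₀ TriangularRing R)
  obtain ⟨f₁, f₂, hc, hfe⟩ := exists_eq_map (f ∘ₗ e.symm.toLinearMap)
  have hsurj : Function.Surjective (map f₁ f₂ hc) := hfe ▸ hf.comp e.symm.surjective
  obtain ⟨hs₁, hs₂⟩ := map_surjective_iff.1 hsurj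
  obtain ⟨s₁, h₁⟩ := LinearMap.exists_lift_of_projective hs₁ LinearMap.id
  obtain ⟨s₂, h₂⟩ := LinearMap.exists_lift_of_projective hs₂ (LinearMap.inr R P Q)
  refine ⟨e.symm.toLinearMap ∘ₗ map s₁ ((ρ ∘ₗ s₁).coprod s₂) fun x => by simp, ?_⟩
  rw [← LinearMap.comp_assoc, hfe]
  refine LinearMap.ext fun m => ?_
  cases m using ind with | _ x y
  obtain ⟨y₁, y₂⟩ := y
  simp [h₁, h₂, hc]

variable {P₁ P₂ : Type v} [AddCommGroup P₁] [AddCommGroup P₂] [Module R P₁] [Module R P₂]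
  {ρ : P₁ →ₗ[R] P₂}

theorem exists_lift (hP : Module.Projective (TriangularRing R) (TripleModule ρ))
    {M₁ M₂ : Type w} [AddCommGroup M₁] [AddCommGroup M₂] [Module R M₁]
    [Module R M₂] {φ : M₁ →ₗ[R] M₂} {N₁ N₂ : Type v'} [AddCommGroup N₁] [AddCommGroup N₂]
    [Module R N₁] [Module R N₂] {ψ : N₁ →ₗ[R] N₂} {p₁ : M₁ →ₗ[R] N₁} {p₂ : M₂ →ₗ[R] N₂}
    (hp : ∀ x, p₂ (φ x) = ψ (p₁ x)) (h₁ : Function.Surjective p₁) (h₂ : Function.Surjective p₂)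
    (f₁ : P₁ →ₗ[R] N₁) (f₂ : P₂ →ₗ[R] N₂) (hf : ∀ x, f₂ (ρ x) = ψ (f₁ x)) :
    ∃ (g₁ : P₁ →ₗ[R] M₁) (g₂ : P₂ →ₗ[R] M₂), (∀ x, g₂ (ρ x) = φ (g₁ x)) ∧
      (∀ x, p₁ (g₁ x) = f₁ x) ∧ ∀ x, p₂ (g₂ x) = f₂ x := by
  obtain ⟨g, hg⟩ := LinearMap.exists_lift_of_projective
    (map_surjective_iff (h := hp).2 ⟨h₁, h₂⟩) (map f₁ f₂ hf)
  obtain ⟨g₁, g₂, hgc, rfl⟩ := exists_eq_map g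
  exact ⟨g₁, g₂, hgc, fun x => (mk_inj.1 (hg (mk ρ x 0))).1, fun y => (mk_inj.1 (hg (mk ρ 0 y))).2⟩

/-- Lifting the identity along (P₁, P₁ × P₂, inl) → (P₁, P₂, ρ) factors the injective map inl
through ρ. -/
theorem injective_of_projective
    (hP : Module.Projective (TriangularRing R) (TripleModule ρ)) :
    Function.Injective ρ := by
  obtain ⟨g₁, g₂, hg, h₁, h₂⟩ := exists_lift hP (φ := LinearMap.inl R P₁ P₂) (ψ := ρ)
    (p₁ := LinearMap.id) (p₂ := ρ.coprod LinearMap.id) (by simp) Function.surjective_id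
    (fun y => ⟨(0, y), by simp⟩) LinearMap.id LinearMap.id (by simp)
  intro x y hxy
  have := (hg x).symm.trans ((congrArg g₂ hxy).trans (hg y))
  exact (h₁ x).symm.trans ((LinearMap.inl_injective this).trans (h₁ y))

/-- Taking second components is left adjoint to the exact functor X ↦ (X, X, id), so it preserves
projectives. -/
theorem projective_snd_of_projective
    (hP : Module.Projective (TriangularRing R) (TripleModule ρ)) :
    Module.Projective R P₂ := by
  refine .of_lifting_property'' fun f hf => ?_
  obtain ⟨g₁, g₂, -, -, h₂⟩ := exists_lift hP (φ := (LinearMap.id : (P₂ →₀ R) →ₗ[R] _))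
    (ψ := (LinearMap.id : P₂ →ₗ[R] P₂)) (p₁ := f) (p₂ := f) (by simp) hf hf ρ LinearMap.id
    (by simp)
  exact ⟨g₂, LinearMap.ext h₂⟩

/-- Likewise, the cokernel is left adjoint to the exact functor X ↦ (0, X, 0). -/
theorem projective_coker_of_projective
    (hP : Module.Projective (TriangularRing R) (TripleModule ρ)) :
    Module.Projective R (P₂ ⧸ LinearMap.range ρ) := by
  refine .of_lifting_property'' fun f hf => ?_
  obtain ⟨g₁, g₂, hg, -, h₂⟩ := exists_lift hP
    (φ := (0 : PUnit.{max u v + 1} →ₗ[R] ((P₂ ⧸ LinearMap.range ρ) →₀ R)))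
    (ψ := (0 : PUnit.{v + 1} →ₗ[R] P₂ ⧸ LinearMap.range ρ)) (p₁ := 0) (p₂ := f) (by simp)
    (fun _ => ⟨0, rfl⟩) hf 0 (LinearMap.range ρ).mkQ
    fun x => (Submodule.Quotient.mk_eq_zero _).2 ⟨x, rfl⟩
  refine ⟨(LinearMap.range ρ).liftQ g₂ ?_, ?_⟩
  · rintro _ ⟨x, rfl⟩
    simp [hg]
  · ext x
    exact h₂ x

end TripleModule

/-! ### Links between triples -/

section Links

variable {R : Type u} [Ring R] {M₁ M₂ N₁ N₂ : Type w} [AddCommGroup M₁] [AddCommGroup M₂]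
  [Module R M₁] [Module R M₂] [AddCommGroup N₁] [AddCommGroup N₂] [Module R N₁] [Module R N₂]
  {φ : M₁ →ₗ[R] M₂} {ψ : N₁ →ₗ[R] N₂}

open TripleModule

theorem ProjectiveLink.exists_squares
    (h : ProjectiveLink (TriangularRing R) (TripleModule φ) (TripleModule ψ)) :
    ∃ (P₁ P₂ : Type w) (_ : AddCommGroup P₁) (_ : AddCommGroup P₂) (_ : Module R P₁)
      (_ : Module R P₂) (ρ : P₁ →ₗ[R] P₂) (i₁ : M₁ →ₗ[R] P₁) (i₂ : M₂ →ₗ[R] P₂)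
      (p₁ : P₁ →ₗ[R] N₁) (p₂ : P₂ →ₗ[R] N₂),
      Module.Projective (TriangularRing R) (TripleModule ρ) ∧
      (∀ x, i₂ (φ x) = ρ (i₁ x)) ∧ (∀ x, p₂ (ρ x) = ψ (p₁ x)) ∧
      (Function.Injective i₁ ∧ Function.Injective i₂) ∧
      (Function.Exact i₁ p₁ ∧ Function.Exact i₂ p₂) ∧
      (Function.Surjective p₁ ∧ Function.Surjective p₂) ∧
      ∀ (G₁ G₂ : Type w) [AddCommGroup G₁] [AddCommGroup G₂] [Module R G₁] [Module R G₂]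
        (γ : G₁ →ₗ[R] G₂), IsFlatModule (TriangularRing R) (TripleModule γ) →
        ∀ (f₁ : M₁ →ₗ[R] G₁) (f₂ : M₂ →ₗ[R] G₂), (∀ x, f₂ (φ x) = γ (f₁ x)) →
        ∃ (g₁ : P₁ →ₗ[R] G₁) (g₂ : P₂ →ₗ[R] G₂), (∀ x, g₂ (ρ x) = γ (g₁ x)) ∧
          (∀ x, g₁ (i₁ x) = f₁ x) ∧ ∀ x, g₂ (i₂ x) = f₂ x := by
  obtain ⟨P, _, _, i, p, _, hi, hip, hp, hG⟩ := h
  obtain ⟨P₁, P₂, _, _, _, _, ρ, ⟨e⟩⟩ := TriangularRing.exists_equiv_triple (R := R) P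
  obtain ⟨i₁, i₂, hic, hie⟩ := exists_eq_map (e.toLinearMap ∘ₗ i)
  obtain ⟨p₁, p₂, hpc, hpe⟩ := exists_eq_map (p ∘ₗ e.symm.toLinearMap)
  have hinj : Function.Injective (map i₁ i₂ hic) := by
    rw [← hie]
    exact e.injective.comp hi
  have hsurj : Function.Surjective (map p₁ p₂ hpc) := by
    rw [← hpe]
    exact hp.comp e.symm.surjective
  refine ⟨P₁, P₂, _, _, _, _, ρ, i₁, i₂, p₁, p₂, .of_equiv e, hic, hpc,
    map_injective_iff.1 hinj, map_exact_iff (h := hic) (h' := hpc).1 ?_,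
    map_surjective_iff.1 hsurj, fun G₁ G₂ _ _ _ _ γ hγ f₁ f₂ hf => ?_⟩
  · rw [← hie, ← hpe]
    intro y
    obtain ⟨x, rfl⟩ := e.surjective y
    simpa using hip x
  · obtain ⟨g, hg⟩ := hG _ hγ (map f₁ f₂ hf)
    obtain ⟨g₁, g₂, hgc, hge⟩ := exists_eq_map (g ∘ₗ e.symm.toLinearMap)
    have key (m) : map g₁ g₂ hgc (map i₁ i₂ hic m) = map f₁ f₂ hf m := by
      rw [← hge, ← hie, ← hg]
      simp
    exact ⟨g₁, g₂, hgc, fun x => (mk_inj.1 (key (mk φ x 0))).1,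
      fun y => (mk_inj.1 (key (mk φ 0 y))).2⟩

theorem ProjectiveLink.injective
    (h : ProjectiveLink (TriangularRing R) (TripleModule φ) (TripleModule ψ)) :
    Function.Injective φ := by
  obtain ⟨P₁, P₂, _, _, _, _, ρ, i₁, i₂, p₁, p₂, hP, hic, -, ⟨hi₁, -⟩, -⟩ := h.exists_squares
  refine .of_comp (f := i₂) ?_
  rw [show i₂ ∘ φ = ρ ∘ i₁ from funext hic]
  exact (injective_of_projective hP).comp hi₁

theorem ProjectiveLink.snd
    (h : ProjectiveLink (TriangularRing R) (TripleModule φ) (TripleModule ψ)) :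
    ProjectiveLink R M₂ N₂ := by
  obtain ⟨P₁, P₂, _, _, _, _, ρ, i₁, i₂, p₁, p₂, hP, hic, hpc, hi, hip, hp, hG⟩ := h.exists_squares
  refine ⟨P₂, _, _, i₂, p₂, projective_snd_of_projective hP, hi.2, hip.2, hp.2,
    fun G _ _ hGf f => ?_⟩
  obtain ⟨g₁, g₂, -, -, hg⟩ := hG G G LinearMap.id hGf.triple_id (f ∘ₗ φ) f (by simp)
  exact ⟨g₂, hg⟩

theorem ProjectiveLink.coker (hψ : Function.Injective ψ)
    (h : ProjectiveLink (TriangularRing R) (TripleModule φ) (TripleModule ψ)) :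
    ProjectiveLink R (M₂ ⧸ LinearMap.range φ) (N₂ ⧸ LinearMap.range ψ) := by
  obtain ⟨P₁, P₂, _, _, _, _, ρ, i₁, i₂, p₁, p₂, hP, hic, hpc, hi, hip, hp, hG⟩ := h.exists_squares
  have hi' : LinearMap.range φ ≤ (LinearMap.range ρ).comap i₂ := by
    rintro _ ⟨x, rfl⟩
    exact ⟨i₁ x, (hic x).symm⟩
  have hp' : LinearMap.range ρ ≤ (LinearMap.range ψ).comap p₂ := by
    rintro _ ⟨x, rfl⟩
    exact ⟨p₁ x, (hpc x).symm⟩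
  refine ⟨P₂ ⧸ LinearMap.range ρ, _, _, Submodule.mapQ _ _ i₂ hi', Submodule.mapQ _ _ p₂ hp',
    projective_coker_of_projective hP, ?_, fun y => ?_, fun y => ?_, fun G _ _ hGf f => ?_⟩
  · rw [injective_iff_map_eq_zero]
    intro m hm
    obtain ⟨m, rfl⟩ := Submodule.mkQ_surjective _ m
    rw [Submodule.mkQ_apply, Submodule.mapQ_apply, Submodule.Quotient.mk_eq_zero] at hm
    obtain ⟨a, ha⟩ := hm
    -- Snake lemma: injectivity of ψ is what keeps the map of cokernels injective.
    obtain ⟨x, rfl⟩ := (hip.1 a).1 (hψ (by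
      rw [← hpc, ha, hip.2.apply_apply_eq_zero, map_zero]))
    rw [Submodule.mkQ_apply, Submodule.Quotient.mk_eq_zero]
    exact ⟨x, hi.2 (by rw [hic, ha])⟩
  · obtain ⟨y, rfl⟩ := Submodule.mkQ_surjective _ y
    constructor
    · intro hy
      rw [Submodule.mkQ_apply, Submodule.mapQ_apply, Submodule.Quotient.mk_eq_zero] at hy
      obtain ⟨n, hn⟩ := hy
      obtain ⟨a, rfl⟩ := hp.1 n
      obtain ⟨m, hm⟩ := (hip.2 (y - ρ a)).1 (by rw [map_sub, hpc, hn, sub_self])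
      refine ⟨Submodule.Quotient.mk m, ?_⟩
      rw [Submodule.mapQ_apply, hm, Submodule.mkQ_apply, Submodule.Quotient.eq]
      exact ⟨-a, by simp⟩
    · rintro ⟨m, hm⟩
      obtain ⟨m, rfl⟩ := Submodule.mkQ_surjective _ m
      rw [← hm, Submodule.mkQ_apply, Submodule.mapQ_apply, Submodule.mapQ_apply,
        hip.2.apply_apply_eq_zero, Submodule.Quotient.mk_zero]
  · obtain ⟨y, rfl⟩ := Submodule.mkQ_surjective _ y
    obtain ⟨a, rfl⟩ := hp.2 y
    exact ⟨Submodule.Quotient.mk a, rfl⟩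
  · obtain ⟨g₁, g₂, hg, -, hg₂⟩ := hG PUnit G 0 hGf.triple_zero 0
      (f ∘ₗ (LinearMap.range φ).mkQ) fun x => by
        have : (LinearMap.range φ).mkQ (φ x) = 0 :=
          (Submodule.Quotient.mk_eq_zero _).2 ⟨x, rfl⟩
        simp [this]
    refine ⟨(LinearMap.range ρ).liftQ g₂ ?_, fun m => ?_⟩
    · rintro _ ⟨x, rfl⟩
      simp [hg]
    · obtain ⟨m, rfl⟩ := Submodule.mkQ_surjective _ m
      exact hg₂ m

/-- A short exact sequence of triples with middle term `P → P × Q` that induces projective links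
on first components and on cokernels is a projective link. -/
theorem ProjectiveLink.triple {C P Q : Type w} [AddCommGroup C] [Module R C]
    [AddCommGroup P] [Module R P] [AddCommGroup Q] [Module R Q]
    [Module.Projective R P] [Module.Projective R Q]
    {π : M₂ →ₗ[R] C} (hφπ : Function.Exact φ π) (hπ : Function.Surjective π)
    {i₁ : M₁ →ₗ[R] P} {p₁ : P →ₗ[R] N₁} (hi₁ : Function.Injective i₁) (hip₁ : Function.Exact i₁ p₁)
    (hp₁ : Function.Surjective p₁)
    (hG₁ : ∀ (G : Type w) [AddCommGroup G] [Module R G], IsFlatModule R G → ∀ f : M₁ →ₗ[R] G,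
        ∃ g : P →ₗ[R] G, ∀ x, g (i₁ x) = f x)
    {j : C →ₗ[R] Q}
    (hG₂ : ∀ (G : Type w) [AddCommGroup G] [Module R G], IsFlatModule R G → ∀ f : C →ₗ[R] G,
        ∃ g : Q →ₗ[R] G, ∀ x, g (j x) = f x)
    {i₂ : M₂ →ₗ[R] P × Q} {p₂ : P × Q →ₗ[R] N₂} (hi₂ : Function.Injective i₂)
    (hip₂ : Function.Exact i₂ p₂) (hp₂ : Function.Surjective p₂)
    (hi : ∀ x, i₂ (φ x) = (i₁ x, 0)) (hij : ∀ m, (i₂ m).2 = j (π m))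
    (hp : ∀ x, p₂ (x, 0) = ψ (p₁ x)) :
    ProjectiveLink (TriangularRing R) (TripleModule φ) (TripleModule ψ) := by
  refine ⟨TripleModule (LinearMap.inl R P Q), inferInstance, inferInstance, map i₁ i₂ hi,
    map p₁ p₂ hp, projective_inl P Q, map_injective_iff.2 ⟨hi₁, hi₂⟩,
    map_exact_iff.2 ⟨hip₁, hip₂⟩, map_surjective_iff.2 ⟨hp₁, hp₂⟩, fun G _ _ hG f => ?_⟩
  obtain ⟨G₁, G₂, _, _, _, _, γ, ⟨e⟩⟩ := TriangularRing.exists_equiv_triple (R := R) G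
  have hγ := hG.of_equiv e
  obtain ⟨f₁, f₂, hf, hfe⟩ := exists_eq_map (e.toLinearMap ∘ₗ f)
  obtain ⟨g₁, hg₁⟩ := hG₁ G₁ hγ.fst_of_triple f₁
  -- On the summand P the second component must be γ ∘ g₁. What remains of `f₂` after subtracting
  -- this part vanishes on the image of φ, so it descends to C and extends to Q.
  obtain ⟨k, hk⟩ := LinearMap.exists_factor_of_surjective hπ
    (f₂ - γ ∘ₗ g₁ ∘ₗ LinearMap.fst R P Q ∘ₗ i₂) fun m hm => by
      obtain ⟨x, rfl⟩ := (hφπ m).1 hm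
      simp [hi, hf, hg₁]
  obtain ⟨l, hl⟩ := hG₂ G₂ hγ.snd_of_triple k
  refine ⟨e.symm.toLinearMap ∘ₗ map g₁ ((γ ∘ₗ g₁).coprod l) fun x => by simp, fun m => ?_⟩
  have h₂ (y : M₂) : ((γ ∘ₗ g₁).coprod l) (i₂ y) = f₂ y := by
    rw [LinearMap.coprod_apply, hij, hl, hk]
    simp
  rw [LinearMap.comp_apply, LinearEquiv.coe_coe, LinearEquiv.symm_apply_eq]
  refine Eq.trans ?_ (LinearMap.congr_fun hfe m).symm
  cases m using ind
  exact mk_inj.2 ⟨hg₁ _, h₂ _⟩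

end Links

/-! ### Triples with a projective chain -/

namespace HasProjectiveChain

variable {R : Type u} [Ring R]

/-! ### Chains on second components and cokernels of triples -/

section

variable {M₁ M₂ : Type w} [AddCommGroup M₁] [AddCommGroup M₂]
  [Module R M₁] [Module R M₂] {φ : M₁ →ₗ[R] M₂}

theorem exists_next_triple (h : HasProjectiveChain (TriangularRing R) (TripleModule φ)) :
    ∃ (N₁ N₂ : Type w) (_ : AddCommGroup N₁) (_ : AddCommGroup N₂) (_ : Module R N₁)
      (_ : Module R N₂) (ψ : N₁ →ₗ[R] N₂),
      HasProjectiveChain (TriangularRing R) (TripleModule ψ) ∧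
      ProjectiveLink (TriangularRing R) (TripleModule φ) (TripleModule ψ) := by
  obtain ⟨Y, _, _, hY, hl⟩ := h.exists_next
  obtain ⟨N₁, N₂, _, _, _, _, ψ, ⟨e⟩⟩ := TriangularRing.exists_equiv_triple (R := R) Y
  exact ⟨N₁, N₂, _, _, _, _, ψ, hY.congr e, hl.congr (.refl _ _) e⟩

theorem exists_prev_triple (h : HasProjectiveChain (TriangularRing R) (TripleModule φ)) :
    ∃ (N₁ N₂ : Type w) (_ : AddCommGroup N₁) (_ : AddCommGroup N₂) (_ : Module R N₁)
      (_ : Module R N₂) (ψ : N₁ →ₗ[R] N₂),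
      HasProjectiveChain (TriangularRing R) (TripleModule ψ) ∧
      ProjectiveLink (TriangularRing R) (TripleModule ψ) (TripleModule φ) := by
  obtain ⟨Y, _, _, hY, hl⟩ := h.exists_prev
  obtain ⟨N₁, N₂, _, _, _, _, ψ, ⟨e⟩⟩ := TriangularRing.exists_equiv_triple (R := R) Y
  exact ⟨N₁, N₂, _, _, _, _, ψ, hY.congr e, hl.congr e (.refl _ _)⟩

theorem injective_of_triple (h : HasProjectiveChain (TriangularRing R) (TripleModule φ)) :
    Function.Injective φ :=
  let ⟨_, _, _, _, _, _, _, _, hl⟩ := h.exists_next_triple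
  hl.injective

theorem snd_of_triple (h : HasProjectiveChain (TriangularRing R) (TripleModule φ)) :
    HasProjectiveChain R M₂ := by
  refine of_class (fun X _ _ => ∃ (X' : Type w) (_ : AddCommGroup X') (_ : Module R X')
    (ξ : X' →ₗ[R] X), HasProjectiveChain (TriangularRing R) (TripleModule ξ)) ?_ ?_ ⟨M₁, _, _, φ, h⟩
  · rintro X _ _ ⟨X', _, _, ξ, hξ⟩
    obtain ⟨N₁, N₂, _, _, _, _, ψ, hψ, hl⟩ := hξ.exists_next_triple
    exact ⟨N₂, _, _, ⟨N₁, _, _, ψ, hψ⟩, hl.snd⟩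
  · rintro X _ _ ⟨X', _, _, ξ, hξ⟩
    obtain ⟨N₁, N₂, _, _, _, _, ψ, hψ, hl⟩ := hξ.exists_prev_triple
    exact ⟨N₂, _, _, ⟨N₁, _, _, ψ, hψ⟩, hl.snd⟩

theorem coker_of_triple (h : HasProjectiveChain (TriangularRing R) (TripleModule φ)) :
    HasProjectiveChain R (M₂ ⧸ LinearMap.range φ) := by
  refine of_class (fun X _ _ => ∃ (X₁ X₂ : Type w) (_ : AddCommGroup X₁) (_ : AddCommGroup X₂)
    (_ : Module R X₁) (_ : Module R X₂) (ξ : X₁ →ₗ[R] X₂),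
    HasProjectiveChain (TriangularRing R) (TripleModule ξ) ∧
      Nonempty ((X₂ ⧸ LinearMap.range ξ) ≃ₗ[R] X)) ?_ ?_ ⟨M₁, M₂, _, _, _, _, φ, h, ⟨.refl _ _⟩⟩
  · rintro X _ _ ⟨X₁, X₂, _, _, _, _, ξ, hξ, ⟨e⟩⟩
    obtain ⟨N₁, N₂, _, _, _, _, ψ, hψ, hl⟩ := hξ.exists_next_triple
    -- The cokernel sequence needs an injective structure map at the right end of the link, supplied
    -- by the chain of that triple.
    exact ⟨_, _, _, ⟨N₁, N₂, _, _, _, _, ψ, hψ, ⟨.refl _ _⟩⟩,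
      (hl.coker hψ.injective_of_triple).congr e (.refl _ _)⟩
  · rintro X _ _ ⟨X₁, X₂, _, _, _, _, ξ, hξ, ⟨e⟩⟩
    obtain ⟨N₁, N₂, _, _, _, _, ψ, hψ, hl⟩ := hξ.exists_prev_triple
    exact ⟨_, _, _, ⟨N₁, N₂, _, _, _, _, ψ, hψ, ⟨.refl _ _⟩⟩,
      (hl.coker hξ.injective_of_triple).congr (.refl _ _) e⟩

end

/-! ### Chains of triples from the first component and the cokernel, and closure properties -/

section

variable {M₁ M₂ C : Type w} [AddCommGroup M₁] [AddCommGroup M₂] [AddCommGroup C]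
  [Module R M₁] [Module R M₂] [Module R C] {φ : M₁ →ₗ[R] M₂} {π : M₂ →ₗ[R] C}

/-- Horseshoe lemma to the right: `i` extends to `t : M₂ → P` since P is flat and C has a chain, and
(t, j ∘ π) embeds M₂ in P × Q. Its cokernel is an extension of D by N₁, so the hypotheses reproduce
themselves. -/
theorem exists_next_of_exact (h₁ : HasProjectiveChain R M₁) (hC : HasProjectiveChain R C)
    (hφ : Function.Injective φ) (hφπ : Function.Exact φ π) (hπ : Function.Surjective π) :
    ∃ (N₁ N₂ D : Type w) (_ : AddCommGroup N₁) (_ : AddCommGroup N₂) (_ : AddCommGroup D)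
      (_ : Module R N₁) (_ : Module R N₂) (_ : Module R D) (ψ : N₁ →ₗ[R] N₂) (θ : N₂ →ₗ[R] D),
      HasProjectiveChain R N₁ ∧ HasProjectiveChain R D ∧ Function.Injective ψ ∧
      Function.Exact ψ θ ∧ Function.Surjective θ ∧
      ProjectiveLink (TriangularRing R) (TripleModule φ) (TripleModule ψ) := by
  obtain ⟨N₁, _, _, hN₁, P, _, _, i, p, _, hi, hip, hp, hG⟩ := h₁.exists_next
  obtain ⟨D, _, _, hD, Q, _, _, j, q, _, hj, hjq, hq, hG'⟩ := hC.exists_next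
  obtain ⟨t, ht⟩ := hC.exists_extension hφ hφπ hπ (.of_projective P) i
  let k : M₂ →ₗ[R] P × Q := t.prod (j ∘ₗ π)
  have hk (m : M₂) : k m = (t m, j (π m)) := rfl
  have hkφ (x : M₁) : k (φ x) = (i x, 0) := by
    rw [hk, ht, hφπ.apply_apply_eq_zero, map_zero]
  have hπ₀ (m : M₂) (h : j (π m) = 0) : ∃ x, φ x = m :=
    (hφπ m).1 (hj (h.trans (map_zero j).symm))
  have hk_inj : Function.Injective k := by
    rw [injective_iff_map_eq_zero]
    intro m hm
    obtain ⟨x, rfl⟩ := hπ₀ m (congrArg Prod.snd hm)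
    have : i x = 0 := (congrArg Prod.fst ((hkφ x).symm.trans hm) :)
    rw [(map_eq_zero_iff i hi).1 this, map_zero]
  let K := LinearMap.range k
  have hK (a : P × Q) : K.mkQ a = 0 ↔ ∃ m, k m = a := Submodule.Quotient.mk_eq_zero _
  obtain ⟨ψ, hψ⟩ := LinearMap.exists_factor_of_surjective hp (K.mkQ ∘ₗ LinearMap.inl R P Q)
    fun a ha => by
      obtain ⟨x, rfl⟩ := (hip a).1 ha
      exact (hK _).2 ⟨φ x, hkφ x⟩
  have hψ' (a : P) : ψ (p a) = K.mkQ (a, 0) := hψ a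
  obtain ⟨θ, hθ⟩ := LinearMap.exists_factor_of_surjective K.mkQ_surjective
    (q ∘ₗ LinearMap.snd R P Q) fun a ha => by
      obtain ⟨m, rfl⟩ := (hK a).1 ha
      simp [hk, hjq.apply_apply_eq_zero]
  have hθ' (a : P × Q) : θ (K.mkQ a) = q a.2 := hθ a
  refine ⟨N₁, (P × Q) ⧸ K, D, _, inferInstance, _, _, inferInstance, _, ψ, θ, hN₁, hD, ?_,
    fun y => ?_, fun d => ?_, ?_⟩
  · rw [injective_iff_map_eq_zero]
    intro y hy
    obtain ⟨a, rfl⟩ := hp y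
    rw [hψ', hK] at hy
    obtain ⟨m, hm⟩ := hy
    obtain ⟨x, rfl⟩ := hπ₀ m (congrArg Prod.snd hm)
    have hx : i x = a := congrArg Prod.fst ((hkφ x).symm.trans hm)
    rw [← hx, hip.apply_apply_eq_zero]
  · obtain ⟨⟨a, b⟩, rfl⟩ := K.mkQ_surjective y
    rw [hθ']
    constructor
    · intro hb
      obtain ⟨c, rfl⟩ := (hjq b).1 hb
      obtain ⟨m, rfl⟩ := hπ c
      refine ⟨p (a - t m), ?_⟩
      rw [hψ', ← sub_eq_zero, ← map_sub, hK]
      exact ⟨-m, by simp [hk]⟩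
    · rintro ⟨n, hn⟩
      obtain ⟨a', rfl⟩ := hp n
      have := congrArg θ hn
      rw [hψ', hθ', hθ'] at this
      simpa using this.symm
  · obtain ⟨b, rfl⟩ := hq d
    exact ⟨K.mkQ (0, b), hθ' _⟩
  · exact .triple hφπ hπ hi hip hp hG hG' hk_inj hK K.mkQ_surjective hkφ (fun m => rfl)
      fun x => (hψ' x).symm

/-- Ordinary horseshoe lemma: lifting Q → C to M₂ covers M₂ by P × Q, with kernel an extension of D
by N₁. -/
theorem exists_prev_of_exact (h₁ : HasProjectiveChain R M₁) (hC : HasProjectiveChain R C)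
    (hφ : Function.Injective φ) (hφπ : Function.Exact φ π) (hπ : Function.Surjective π) :
    ∃ (N₁ N₂ D : Type w) (_ : AddCommGroup N₁) (_ : AddCommGroup N₂) (_ : AddCommGroup D)
      (_ : Module R N₁) (_ : Module R N₂) (_ : Module R D) (ψ : N₁ →ₗ[R] N₂) (θ : N₂ →ₗ[R] D),
      HasProjectiveChain R N₁ ∧ HasProjectiveChain R D ∧ Function.Injective ψ ∧
      Function.Exact ψ θ ∧ Function.Surjective θ ∧
      ProjectiveLink (TriangularRing R) (TripleModule ψ) (TripleModule φ) := by
  obtain ⟨N₁, _, _, hN₁, P, _, _, i, p, _, hi, hip, hp, hG⟩ := h₁.exists_prev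
  obtain ⟨D, _, _, hD, Q, _, _, j, q, _, hj, hjq, hq, hG'⟩ := hC.exists_prev
  obtain ⟨l, hl⟩ := LinearMap.exists_lift_of_projective hπ q
  let r : P × Q →ₗ[R] M₂ := (φ ∘ₗ p).coprod l
  have hr (a : P) (b : Q) : r (a, b) = φ (p a) + l b := rfl
  have hr_surj : Function.Surjective r := by
    intro m
    obtain ⟨b, hb⟩ := hq (π m)
    obtain ⟨x, hx⟩ := (hφπ (m - l b)).1 (by rw [map_sub, hl, hb, sub_self])
    obtain ⟨a, rfl⟩ := hp x
    exact ⟨(a, b), by rw [hr, hx, sub_add_cancel]⟩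
  let K := LinearMap.ker r
  obtain ⟨ψ, hψ⟩ := LinearMap.exists_factor_of_injective K.injective_subtype
    (LinearMap.inl R P Q ∘ₗ i) fun y => ⟨⟨(i y, 0), by
      rw [LinearMap.mem_ker, hr, hip.apply_apply_eq_zero, map_zero, map_zero, add_zero]⟩, rfl⟩
  have hψ' (y : N₁) : (ψ y : P × Q) = (i y, 0) := hψ y
  have hqr (a : P) (b : Q) : π (r (a, b)) = q b := by
    rw [hr, map_add, hφπ.apply_apply_eq_zero, hl, zero_add]
  obtain ⟨θ, hθ⟩ := LinearMap.exists_factor_of_injective hj (LinearMap.snd R P Q ∘ₗ K.subtype) <| by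
    rintro ⟨⟨a, b⟩, hab⟩
    exact (hjq b).1 (by rw [← hqr a b, LinearMap.mem_ker.1 hab, map_zero])
  have hθ' (a : K) : j (θ a) = a.1.2 := hθ a
  have hψθ : Function.Exact ψ θ := fun y => by
    rw [← map_eq_zero_iff j hj, hθ']
    obtain ⟨⟨a, b⟩, hab⟩ := y
    constructor
    · rintro (rfl : b = 0)
      rw [LinearMap.mem_ker, hr, map_zero, add_zero, map_eq_zero_iff φ hφ] at hab
      obtain ⟨y, rfl⟩ := (hip a).1 hab
      exact ⟨y, Subtype.ext (hψ' y)⟩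
    · rintro ⟨y, hy⟩
      rw [← hy, hψ']
  have hθ_surj : Function.Surjective θ := fun d => by
    obtain ⟨x, hx⟩ := (hφπ (l (j d))).1 (by rw [hl, hjq.apply_apply_eq_zero])
    obtain ⟨a, rfl⟩ := hp x
    refine ⟨⟨(-a, j d), ?_⟩, hj (hθ' _)⟩
    rw [LinearMap.mem_ker, hr, map_neg, map_neg, hx, neg_add_cancel]
  refine ⟨N₁, K, D, _, inferInstance, _, _, inferInstance, _, ψ, θ, hN₁, hD, fun x y h => ?_,
    hψθ, hθ_surj, ?_⟩
  · have := congrArg Subtype.val h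
    rw [hψ', hψ'] at this
    exact hi (congrArg Prod.fst this)
  · exact .triple hψθ hθ_surj hi hip hp hG hG' K.injective_subtype
      (LinearMap.exact_subtype_ker_map r) hr_surj hψ' (fun m => (hθ' m).symm)
      fun x => by rw [hr, map_zero, add_zero]

theorem triple (h₁ : HasProjectiveChain R M₁) (hC : HasProjectiveChain R C)
    (hφ : Function.Injective φ) (hφπ : Function.Exact φ π) (hπ : Function.Surjective π) :
    HasProjectiveChain (TriangularRing R) (TripleModule φ) := by
  refine of_class (fun X _ _ => ∃ (N₁ N₂ D : Type w) (_ : AddCommGroup N₁) (_ : AddCommGroup N₂)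
      (_ : AddCommGroup D) (_ : Module R N₁) (_ : Module R N₂) (_ : Module R D) (ψ : N₁ →ₗ[R] N₂)
      (θ : N₂ →ₗ[R] D), HasProjectiveChain R N₁ ∧ HasProjectiveChain R D ∧ Function.Injective ψ ∧
      Function.Exact ψ θ ∧ Function.Surjective θ ∧
      Nonempty (TripleModule ψ ≃ₗ[TriangularRing R] X)) ?_ ?_
      ⟨M₁, M₂, C, _, _, _, _, _, _, φ, π, h₁, hC, hφ, hφπ, hπ, ⟨.refl _ _⟩⟩
  · rintro X _ _ ⟨M₁, M₂, C, _, _, _, _, _, _, φ, π, h₁, hC, hφ, hφπ, hπ, ⟨e⟩⟩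
    obtain ⟨N₁, N₂, D, _, _, _, _, _, _, ψ, θ, h₁, hD, hψ, hψθ, hθ, hl⟩ :=
      exists_next_of_exact h₁ hC hφ hφπ hπ
    exact ⟨_, _, _, ⟨N₁, N₂, D, _, _, _, _, _, _, ψ, θ, h₁, hD, hψ, hψθ, hθ, ⟨.refl _ _⟩⟩,
      hl.congr e (.refl _ _)⟩
  · rintro X _ _ ⟨M₁, M₂, C, _, _, _, _, _, _, φ, π, h₁, hC, hφ, hφπ, hπ, ⟨e⟩⟩
    obtain ⟨N₁, N₂, D, _, _, _, _, _, _, ψ, θ, h₁, hD, hψ, hψθ, hθ, hl⟩ :=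
      exists_prev_of_exact h₁ hC hφ hφπ hπ
    exact ⟨_, _, _, ⟨N₁, N₂, D, _, _, _, _, _, _, ψ, θ, h₁, hD, hψ, hψθ, hθ, ⟨.refl _ _⟩⟩,
      hl.congr (.refl _ _) e⟩

/-- Modules with a projective chain are closed under extensions. -/
theorem of_extension (h₁ : HasProjectiveChain R M₁) (hC : HasProjectiveChain R C)
    (hφ : Function.Injective φ) (hφπ : Function.Exact φ π) (hπ : Function.Surjective π) :
    HasProjectiveChain R M₂ :=
  (triple h₁ hC hφ hφπ hπ).snd_of_triple

/-- Modules with a projective chain are closed under kernels of epimorphisms. -/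
theorem of_kernel (h₂ : HasProjectiveChain R M₂) (hC : HasProjectiveChain R C)
    (hφ : Function.Injective φ) (hφπ : Function.Exact φ π) (hπ : Function.Surjective π) :
    HasProjectiveChain R M₁ := by
  obtain ⟨K, _, _, hK, Q, _, _, j, q, _, hj, hjq, hq, -⟩ := hC.exists_prev
  -- E is the pullback of M₂ → C ← Q. Its projection to M₂ has kernel K, so E is an extension of
  -- Ding projectives; its projection to the projective module Q has kernel M₁.
  let E := LinearMap.ker (π.coprod (-q))
  have hE (m : M₂) (b : Q) : (m, b) ∈ E ↔ π m = q b := by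
    simp [E, LinearMap.mem_ker, ← sub_eq_add_neg, sub_eq_zero]
  have memE (a : E) : π a.1.1 = q a.1.2 := (hE _ _).1 a.2
  obtain ⟨α, hα⟩ := LinearMap.exists_factor_of_injective E.injective_subtype
    (LinearMap.inr R M₂ Q ∘ₗ j) fun y => ⟨⟨(0, j y), by
      rw [hE, map_zero, hjq.apply_apply_eq_zero]⟩, rfl⟩
  have hα' (y : K) : (α y : M₂ × Q) = (0, j y) := hα y
  obtain ⟨β, hβ⟩ := LinearMap.exists_factor_of_injective E.injective_subtype
    (LinearMap.inl R M₂ Q ∘ₗ φ) fun x => ⟨⟨(φ x, 0), by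
      rw [hE, map_zero, hφπ.apply_apply_eq_zero]⟩, rfl⟩
  have hβ' (x : M₁) : (β x : M₂ × Q) = (φ x, 0) := hβ x
  have hEc : HasProjectiveChain R E := by
    refine of_extension (φ := α) (π := LinearMap.fst R M₂ Q ∘ₗ E.subtype) hK h₂
      (fun x y h => ?_) (fun a => ⟨fun h => ?_, ?_⟩) fun m => ?_
    · have := congrArg Subtype.val h
      rw [hα', hα'] at this
      exact hj (congrArg Prod.snd this)
    · have h0 : a.1.1 = 0 := h
      obtain ⟨y, hy⟩ := (hjq a.1.2).1 (by rw [← memE, h0, map_zero])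
      exact ⟨y, Subtype.ext ((hα' y).trans (Prod.ext h0.symm hy))⟩
    · rintro ⟨y, rfl⟩
      change (α y).1.1 = 0
      rw [hα']
    · obtain ⟨b, hb⟩ := hq (π m)
      exact ⟨⟨(m, b), (hE m b).2 hb.symm⟩, rfl⟩
  refine hEc.of_exact_of_projective (i := β) (p := LinearMap.snd R M₂ Q ∘ₗ E.subtype)
    (fun x y h => ?_) (fun a => ⟨fun h => ?_, ?_⟩) fun b => ?_
  · have := congrArg Subtype.val h
    rw [hβ', hβ'] at this
    exact hφ (congrArg Prod.fst this)
  · have h0 : a.1.2 = 0 := h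
    obtain ⟨x, hx⟩ := (hφπ a.1.1).1 (by rw [memE, h0, map_zero])
    exact ⟨x, Subtype.ext ((hβ' x).trans (Prod.ext hx h0.symm))⟩
  · rintro ⟨x, rfl⟩
    change (β x).1.2 = 0
    rw [hβ']
  · obtain ⟨m, hm⟩ := hπ (q b)
    exact ⟨⟨(m, b), (hE m b).2 hm⟩, rfl⟩

end

end HasProjectiveChain

theorem corollary3p5 (R : Type u) [Ring R] (M₁ M₂ : Type v) [AddCommGroup M₁] [AddCommGroup M₂]
    [Module R M₁] [Module R M₂] (φ : M₁ →ₗ[R] M₂) :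
    List.TFAE [
      IsDingProjective (TriangularRing R) (TripleModule φ),
      IsDingProjective R M₁ ∧ IsDingProjective R (M₂ ⧸ LinearMap.range φ) ∧ Function.Injective φ,
      IsDingProjective R M₂ ∧ IsDingProjective R (M₂ ⧸ LinearMap.range φ) ∧
        Function.Injective φ] := by
  -- Chains keep all modules in one universe, while the projectives in the definition live in `max u
  -- v`; the whole triple is lifted there first.
  let e₁ : M₁ ≃ₗ[R] ULift.{u} M₁ := ULift.moduleEquiv.symm
  let e₂ : M₂ ≃ₗ[R] ULift.{u} M₂ := ULift.moduleEquiv.symm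
  let ψ : ULift.{u} M₁ →ₗ[R] ULift.{u} M₂ := e₂.toLinearMap ∘ₗ φ ∘ₗ e₁.symm.toLinearMap
  have hc (x : M₁) : e₂ (φ x) = ψ (e₁ x) := by simp [ψ]
  have hr : (LinearMap.range φ).map e₂.toLinearMap = LinearMap.range ψ := by
    rw [LinearMap.range_comp, LinearMap.range_comp_of_range_eq_top φ e₁.symm.range]
  have hψ : Function.Injective ψ ↔ Function.Injective φ :=
    (EquivLike.comp_injective _ e₂).trans (EquivLike.injective_comp e₁.symm φ)
  have hexact : Function.Exact ψ (LinearMap.range ψ).mkQ := LinearMap.exact_map_mkQ_range ψ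
  have hsurj := (LinearMap.range ψ).mkQ_surjective
  rw [isDingProjective_iff_hasProjectiveChain (TripleModule.equiv e₁ e₂ hc),
    isDingProjective_iff_hasProjectiveChain e₁, isDingProjective_iff_hasProjectiveChain e₂,
    isDingProjective_iff_hasProjectiveChain (Submodule.Quotient.equiv _ _ e₂ hr), ← hψ]
  tfae_have 1 → 3 := fun h => ⟨h.snd_of_triple, h.coker_of_triple, h.injective_of_triple⟩
  tfae_have 3 → 2 := fun ⟨h₂, hC, hi⟩ => ⟨h₂.of_kernel hC hi hexact hsurj, hC, hi⟩
  tfae_have 2 → 1 := fun ⟨h₁, hC, hi⟩ => .triple h₁ hC hi hexact hsurj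
  tfae_finish
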